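/- Let $N\ge 1$ be an integer, $p>2$, $p'=p/(p-1)$, $\phi_q(\xi)=|\xi|^{q-2}\xi$, and let $Y=C^0[0,1]$ with the sup norm. Let $f:[0,1]\times\mathbb R\to\mathbb R$ be continuous, let $f_0,f_\infty\in Y$, and assume the following hypotheses (H'). - $f(r,\cdot)\in C^1(\mathbb R)$ for all $r\in[0,1]$, and $\partial_2 f$ is continuous on $[0,1]\times\mathbb R$. - $f(r,\xi)\xi>0$ for $r\in[0,1]$, $\xi\ne0$, and $f(r,0)=0$. - $(p-1)f(r,\xi)\ge\partial_2f(r,\xi)\xi$ for $\xi\ge0$ and $(p-1)f(r,\xi)\le\partial_2f(r,\xi)\xi$ for $\xi\le0$, $r\in[0,1]$; and there are $\delta,\epsilon>0$ such that for $r\in(1-\delta,1]$ (and $r \in [0,1]$) the first inequality is strict for $\xi\in(0,\epsilon)$ and the second is strict for $\xi\in(-\epsilon,0)$. - As $\xi\to0$, $f(r,\xi)/\phi_p(\xi)\to f_0(r)$ and $\partial_2f(r,\xi)/|\xi|^{p-2}\to(p-1)f_0(r)$, uniformly in $r\in[0,1]$. - As $|\xi|\to\infty$, $f(r,\xi)/\phi_p(\xi)\to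 f_\infty(r)$, uniformly in $r\in[0,1]$. - Either $f_\infty>0$ on $[0,1]$, or $N=1$ and $f_\infty\equiv0$. For $h\in Y$ put $$S_p(h)(r)=\int_r^1\phi_{p'}\Big(\int_0^s (t/s)^{N-1}h(t)\,dt\Big)ds,$$ and for $\lambda\in\mathbb R$, $u\in Y$ put $F(\lambda,u)=u-\phi_{p'}(\lambda)\,S_p(f(\cdot,u))$; so $F(\lambda,u)=u-\lambda^{1/(p-1)}S_p(f(\cdot,u))$ for $\lambda\ge0$. Let $$\mathcal S^\pm=\{(\lambda,u)\in(0,\infty)\times Y: F(\lambda,u)=0,\ u\not\equiv0,\ \pm u\ge0\}.$$ Then there is exactly one pair $(\lambda_0,v_0)\in\mathbb R\times Y$ such that $v_0\in C^1[0,1]$, $\phi_p(v_0')\in C^1[0,1]$, $-(r^{N-1}\phi_p(v_0'))'=\lambda_0r^{N-1}f_0\phi_p(v_0)$ on $(0,1)$, $v_0'(0)=v_0(1)=0$, $v_0>0$ on $[0,1)$ and $\int_0^1r^{N-1}f_0|v_0|^p\,dr=1$. Put $$Z=\Big\{z\in Y:\int_0^1r^{N-1}f_0|v_0|^{p-2}v_0z\,dr=0\Big\},$$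 and define $G:\mathbb R^2\times Z\to Y$ by $G(s,\lambda,z)=v_0+z-S_p(\lambda f(\cdot,sv_0+sz)/\phi_p(s))$ for $s\ne0$ and $G(0,\lambda,z)=v_0+z-S_p(\lambda f_0\phi_p(v_0+z))$. There exist $\varepsilon>0$, a neighbourhood $U$ of $(\lambda_0,0)$ in $\mathbb R\times Z$ and a continuous map $s\mapsto(\lambda(s),z(s))$ from $(-\varepsilon,\varepsilon)$ to $U$ with $(\lambda(0),z(0))=(\lambda_0,0)$ and $$\{(s,\lambda,z)\in(-\varepsilon,\varepsilon)\times U:G(s,\lambda,z)=0\}=\{(s,\lambda(s),z(s)):s\in(-\varepsilon,\varepsilon)\}.$$ Moreover, for every such $\varepsilon$, $U$ and $s\mapsto(\lambda(s),z(s))$ there exist $\varepsilon_1\in(0,\varepsilon)$ and a neighbourhood $U_1$ of $(\lambda_0,0)$ in $\mathbb R\times Y$ such that $$\{(\lambda,u)\in U_1:F(\lambda,u)=0\}=\{(\lambda,u)\in U_1:u=0\}\cup\{(\lambda(s),s(v_0+z(s))):s\in(-\varepsilon_1,\varepsilon_1)\},$$ with $$\{(\lambda(s),s(v_0+z(s))):s\in(-\varepsilon_1,0)\}\subset\mathcal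 S^-\quad\text{and}\quad\{(\lambda(s),s(v_0+z(s))):s\in(0,\varepsilon_1)\}\subset\mathcal S^+.$$ -/

import Mathlib

open Set Filter Topology

namespace RadialPLaplacian

noncomputable section

/-- The space `Y = C⁰[0,1]` with the sup norm. -/
abbrev Y : Type := C(unitInterval, ℝ)

/-- An element of `Y` as a function on `ℝ`; on `[0,1]` it is the function itself, and outside
`[0,1]` it is continued by its boundary values. -/
def ext (u : Y) : ℝ → ℝ := Set.IccExtend (zero_le_one' ℝ) u

theorem continuous_ext (u : Y) : Continuous (ext u) := u.continuous.Icc_extend'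

theorem ext_coe (u : Y) (r : unitInterval) : ext u r = u r :=
  Set.IccExtend_val (zero_le_one' ℝ) u r

/-- `φ_p(ξ) = |ξ|^(p-2) ξ`. -/
def phi (p ξ : ℝ) : ℝ := |ξ| ^ (p - 2) * ξ

/-- For `ξ ≥ 0` one has `φ_p(ξ) = ξ^(p-1)`. -/
theorem phi_of_nonneg {p : ℝ} (hp : 1 < p) {ξ : ℝ} (hξ : 0 ≤ ξ) : phi p ξ = ξ ^ (p - 1) := by
  unfold phi
  rcases hξ.eq_or_lt with rfl | h
  · rw [mul_zero, Real.zero_rpow (by linarith)]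
  · rw [abs_of_pos h, ← Real.rpow_add_one h.ne']
    congr 1
    ring

theorem continuous_phi {p : ℝ} (hp : 1 < p) : Continuous (phi p) := by
  have h : phi p = fun ξ : ℝ => (max ξ 0) ^ (p - 1) - (max (-ξ) 0) ^ (p - 1) := by
    funext ξ
    have h0 : (0 : ℝ) ^ (p - 1) = 0 := Real.zero_rpow (by linarith)
    rcases le_total 0 ξ with hξ | hξ
    · rw [phi_of_nonneg hp hξ, max_eq_left hξ, max_eq_right (neg_nonpos.mpr hξ), h0, sub_zero]
    · have h1 : phi p ξ = - phi p (-ξ) := by simp [phi]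
      rw [h1, phi_of_nonneg hp (neg_nonneg.mpr hξ), max_eq_right hξ,
        max_eq_left (neg_nonneg.mpr hξ), h0, zero_sub]
  rw [h]
  have hq : 0 ≤ p - 1 := by linarith
  exact ((continuous_id.max continuous_const).rpow_const (fun _ => Or.inr hq)).sub
    ((continuous_neg.max continuous_const).rpow_const (fun _ => Or.inr hq))

/-- The conjugate exponent `p' = p / (p - 1)`. -/
def conj (p : ℝ) : ℝ := p / (p - 1)

theorem one_lt_conj {p : ℝ} (hp : 1 < p) : 1 < conj p := by
  unfold conj
  rw [lt_div_iff₀ (by linarith)]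
  linarith

/-- The Nemytskii operator `Φ_q : Y → Y`, `Φ_q(g)(s) = φ_q(g(s))`. -/
def Phi {q : ℝ} (hq : 1 < q) (g : Y) : Y := ⟨fun s => phi q (g s), (continuous_phi hq).comp g.continuous⟩

/-- The Nemytskii operator `Y → Y` of a continuous function `h` on `[0,1] × ℝ`:
`h(u)(r) = h(r, u(r))`. -/
def nemytskii (h : C(unitInterval × ℝ, ℝ)) (u : Y) : Y :=
  ⟨fun r => h (r, u r), by fun_prop⟩

/-- `J(h)(s) = ∫₀ˢ (t/s)^(N-1) h(t) dt`. -/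
def J (N : ℕ) (h : Y) (s : ℝ) : ℝ := ∫ t in (0 : ℝ)..s, (t / s) ^ (N - 1) * ext h t

theorem J_eq (N : ℕ) (h : Y) (s : ℝ) :
    J N h s = s * ∫ τ in (0 : ℝ)..1, τ ^ (N - 1) * ext h (s * τ) := by
  rcases eq_or_ne s 0 with rfl | hs
  · simp [J]
  · have h1 := intervalIntegral.smul_integral_comp_mul_left (a := 0) (b := 1)
      (fun t => (t / s) ^ (N - 1) * ext h t) s
    rw [mul_zero, mul_one] at h1
    rw [J, ← h1, smul_eq_mul]
    simp only [mul_div_cancel_left₀ _ hs]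

theorem continuous_J (N : ℕ) (h : Y) : Continuous (J N h) := by
  have h1 : J N h = fun s => s * ∫ τ in (0 : ℝ)..1, τ ^ (N - 1) * ext h (s * τ) :=
    funext (J_eq N h)
  rw [h1]
  have h2 := continuous_ext h
  refine continuous_id.mul
    (intervalIntegral.continuous_parametric_intervalIntegral_of_continuous' ?_ 0 1)
  exact ((continuous_snd.pow _).mul (h2.comp (continuous_fst.mul continuous_snd)))

/-- The inverse `p`-Laplacian
`S_p(h)(r) = ∫ᵣ¹ φ_{p'} (∫₀ˢ (t/s)^(N-1) h(t) dt) ds`, as a map `Y → Y`. -/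
def S (N : ℕ) {p : ℝ} (hp : 1 < p) (h : Y) : Y :=
  ⟨fun r => ∫ s in (r : ℝ)..1, phi (conj p) (J N h s), by
    have hc : Continuous fun s => phi (conj p) (J N h s) :=
      (continuous_phi (one_lt_conj hp)).comp (continuous_J N h)
    simp only [fun r : ℝ => intervalIntegral.integral_symm (μ := MeasureTheory.volume)
      (f := fun s => phi (conj p) (J N h s)) 1 r]
    exact ((intervalIntegral.continuous_primitive (fun a b => hc.intervalIntegrable a b) 1).comp
      continuous_subtype_val).neg⟩

/-- `F(λ,u) = u - λ^{p*} S_p(f(u))`, where `p* = 1/(p-1) = p' - 1`. The factor is written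
`φ_{p'}(λ)`: this is `λ^{p*}` for `λ ≥ 0` and `-|λ|^{p*}` for `λ < 0`, so that `F(λ,u)` is
`u - S_p(λ f(u))` for every real `λ`. -/
def F (N : ℕ) {p : ℝ} (hp : 1 < p) (f : C(unitInterval × ℝ, ℝ)) (lam : ℝ) (u : Y) : Y :=
  u - phi (conj p) lam • S N hp (nemytskii f u)

theorem phi_conj_of_nonneg {p : ℝ} (hp : 1 < p) {lam : ℝ} (h : 0 ≤ lam) :
    phi (conj p) lam = lam ^ (1 / (p - 1)) := by
  rw [phi_of_nonneg (one_lt_conj hp) h]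
  congr 1
  have : p - 1 ≠ 0 := by linarith
  unfold conj
  field_simp
  ring

/-- The set `S⁺` of non-trivial non-negative solutions. -/
def solPos (N : ℕ) {p : ℝ} (hp : 1 < p) (f : C(unitInterval × ℝ, ℝ)) : Set (ℝ × Y) :=
  {x | 0 < x.1 ∧ F N hp f x.1 x.2 = 0 ∧ x.2 ≠ 0 ∧ ∀ r, 0 ≤ x.2 r}

/-- The set `S⁻` of non-trivial non-positive solutions. -/
def solNeg (N : ℕ) {p : ℝ} (hp : 1 < p) (f : C(unitInterval × ℝ, ℝ)) : Set (ℝ × Y) :=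
  {x | 0 < x.1 ∧ F N hp f x.1 x.2 = 0 ∧ x.2 ≠ 0 ∧ ∀ r, x.2 r ≤ 0}

/-- The partial derivative `∂₂f(r,ξ)`. -/
def d2 (f : C(unitInterval × ℝ, ℝ)) (r : unitInterval) (ξ : ℝ) : ℝ :=
  deriv (fun η => f (r, η)) ξ

/-- The hypotheses on the nonlinearity `f` and its asymptotes `f₀`, `f_∞`. -/
structure Hyp (N : ℕ) (p : ℝ) (f : C(unitInterval × ℝ, ℝ)) (f₀ finf : Y) : Prop where
  /-- `f(r,·) ∈ C¹(ℝ)` and `∂₂f` is continuous on `[0,1] × ℝ`. -/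
  contDiff : ∀ r, ContDiff ℝ 1 fun ξ => f (r, ξ)
  continuous_d2 : Continuous fun x : unitInterval × ℝ => d2 f x.1 x.2
  /-- Sign condition. -/
  sign : ∀ r ξ, ξ ≠ 0 → 0 < f (r, ξ) * ξ
  zero : ∀ r, f (r, 0) = 0
  /-- Monotonicity conditions, strict for `r` near `1` and small `ξ ≠ 0`. -/
  mono_pos : ∀ r ξ, 0 ≤ ξ → d2 f r ξ * ξ ≤ (p - 1) * f (r, ξ)
  mono_neg : ∀ r ξ, ξ ≤ 0 → (p - 1) * f (r, ξ) ≤ d2 f r ξ * ξ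
  mono_strict : ∃ δ > 0, ∃ ε > 0, ∀ r : unitInterval, 1 - δ < (r : ℝ) →
    (∀ ξ ∈ Ioo 0 ε, d2 f r ξ * ξ < (p - 1) * f (r, ξ)) ∧
    (∀ ξ ∈ Ioo (-ε) 0, (p - 1) * f (r, ξ) < d2 f r ξ * ξ)
  /-- Behaviour as `ξ → 0`, uniformly in `r ∈ [0,1]`. -/
  lim_zero : TendstoUniformly (fun ξ r => f (r, ξ) / phi p ξ) f₀ (𝓝[≠] 0)
  lim_zero_d2 : TendstoUniformly (fun ξ r => d2 f r ξ / |ξ| ^ (p - 2))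
    (fun r => (p - 1) * f₀ r) (𝓝[≠] 0)
  /-- Behaviour as `|ξ| → ∞`, uniformly in `r ∈ [0,1]`. -/
  lim_infty : TendstoUniformly (fun ξ r => f (r, ξ) / phi p ξ) finf (atBot ⊔ atTop)
  /-- Either `f_∞ > 0` on `[0,1]`, or `N = 1` and `f_∞ ≡ 0`. -/
  infty : (∀ r, 0 < finf r) ∨ (N = 1 ∧ finf = 0)

/-- The derivative `u'` on `[0,1]` (one-sided at the end points). -/
def D (u : Y) : ℝ → ℝ := derivWithin (ext u) (Icc 0 1)

/-- `u ∈ X_p`: `u ∈ C¹[0,1]`, `φ_p(u') ∈ C¹[0,1]`, `u'(0) = u(1) = 0`. -/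
def MemX (p : ℝ) (u : Y) : Prop :=
  ContDiffOn ℝ 1 (ext u) (Icc 0 1) ∧ ContDiffOn ℝ 1 (fun r => phi p (D u r)) (Icc 0 1) ∧
    D u 0 = 0 ∧ u 1 = 0

/-- `(λ₀, v₀)` is the normalized principal eigenpair of the weighted problem
`-(r^(N-1) φ_p(v'))' = λ r^(N-1) f₀(r) φ_p(v)` on `(0,1)`, `v'(0) = v(1) = 0`: the eigenfunction
`v₀` is positive on `[0,1)` and `∫₀¹ r^(N-1) f₀ |v₀|^p dr = 1`. -/
structure IsPrincipal (N : ℕ) (p : ℝ) (f₀ : Y) (lam₀ : ℝ) (v₀ : Y) : Prop where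
  mem : MemX p v₀
  eqn : ∀ r ∈ Ioo (0 : ℝ) 1, -deriv (fun s => s ^ (N - 1) * phi p (D v₀ s)) r =
    lam₀ * r ^ (N - 1) * ext f₀ r * phi p (ext v₀ r)
  pos : ∀ r : unitInterval, (r : ℝ) < 1 → 0 < v₀ r
  normalized : ∫ r in (0 : ℝ)..1, r ^ (N - 1) * ext f₀ r * |ext v₀ r| ^ p = 1

/-- `Z = {z ∈ Y : ∫₀¹ r^(N-1) f₀ |v₀|^(p-2) v₀ z dr = 0}`. -/
def Z (N : ℕ) {p : ℝ} (hp : 1 < p) (f₀ v₀ : Y) : Submodule ℝ Y where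
  carrier := {z | ∫ r in (0 : ℝ)..1, r ^ (N - 1) * ext f₀ r * phi p (ext v₀ r) * ext z r = 0}
  zero_mem' := by
    have h : ∀ r, ext (0 : Y) r = 0 := fun _ => rfl
    simp [h]
  add_mem' := by
    intro a b ha hb
    have hc : ∀ z : Y, Continuous fun r : ℝ =>
        r ^ (N - 1) * ext f₀ r * phi p (ext v₀ r) * ext z r := fun z =>
      (((continuous_id.pow _).mul (continuous_ext f₀)).mul
        ((continuous_phi hp).comp (continuous_ext v₀))).mul (continuous_ext z)
    have h : ∀ r, ext (a + b) r = ext a r + ext b r := fun _ => rfl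
    simp only [mem_ofPred_eq] at ha hb ⊢
    simp only [h, mul_add]
    rw [intervalIntegral.integral_add ((hc a).intervalIntegrable _ _)
      ((hc b).intervalIntegrable _ _), ha, hb, add_zero]
  smul_mem' := by
    intro c a ha
    have h : ∀ r, ext (c • a) r = c * ext a r := fun _ => rfl
    simp only [mem_ofPred_eq] at ha ⊢
    simp only [h, mul_left_comm _ c]
    rw [intervalIntegral.integral_const_mul, ha, mul_zero]

/-- The rescaled operator `G : ℝ² × Z → Y`. -/
def G (N : ℕ) {p : ℝ} (hp : 1 < p) (f : C(unitInterval × ℝ, ℝ)) (f₀ v₀ : Y)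
    (s lam : ℝ) (z : Z N hp f₀ v₀) : Y :=
  if s = 0 then v₀ + z - S N hp (lam • (f₀ * Phi hp (v₀ + z)))
  else v₀ + z - S N hp ((lam / phi p s) • nemytskii f (s • (v₀ + z)))

/-- `s ↦ (λ(s), z(s))`, `s ∈ (-ε,ε)`, is a continuous local branch of zeros of `G` through
`(λ₀,0)`, and it contains all zeros `(s,λ,z)` of `G` with `|s| < ε` and `(λ,z) ∈ U`, where
`U` is a neighbourhood of `(λ₀,0)` in `ℝ × Z`. -/
structure IsLocalBranch (N : ℕ) {p : ℝ} (hp : 1 < p) (f : C(unitInterval × ℝ, ℝ)) (f₀ : Y)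
    (lam₀ : ℝ) (v₀ : Y) (ε : ℝ) (U : Set (ℝ × Z N hp f₀ v₀))
    (lam : ℝ → ℝ) (z : ℝ → Z N hp f₀ v₀) : Prop where
  pos : 0 < ε
  nhds : U ∈ 𝓝 ((lam₀, 0) : ℝ × Z N hp f₀ v₀)
  continuousOn : ContinuousOn (fun s => (lam s, z s)) (Ioo (-ε) ε)
  lam_zero : lam 0 = lam₀
  z_zero : z 0 = 0
  zeros : {x : ℝ × ℝ × Z N hp f₀ v₀ |
      x.1 ∈ Ioo (-ε) ε ∧ x.2 ∈ U ∧ G N hp f f₀ v₀ x.1 x.2.1 x.2.2 = 0} =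
    (fun s => (s, lam s, z s)) '' Ioo (-ε) ε

/-- The point `(λ(s), s(v₀ + z(s)))` of `ℝ × Y`. -/
def branchPoint (v₀ : Y) {V : Submodule ℝ Y} (lam : ℝ → ℝ) (z : ℝ → V) (s : ℝ) : ℝ × Y :=
  (lam s, s • (v₀ + (z s : Y)))

end

end RadialPLaplacian

namespace RadialPLaplacian

noncomputable section

/-! ### The function `φ_q` -/

/-! The branch is obtained from order and compactness, without an implicit function theorem. Put q =
f/φ_p, continued by f₀ at ξ = 0. Then F(λ,u) = 0 means u = S_p(λ q(·,u) φ_p(u)), and G(s,λ,z) = 0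
means w = S_p(λ q(·,sw) φ_p(w)) with w = v₀ + z; for s ≠ 0 the two are related by u = sw. With σ(u)
= ∫ r^(N-1) f₀ φ_p(v₀) u dr, the condition z ∈ Z becomes σ(w) = 1, so σ(u) = s is the branch
parameter.

The engine is strong monotonicity, `exists_le_S_sub`: if a ≤ b and a ≠ b, then S_p(b) - S_p(a) ≥
c(1-r) with c > 0, while S_p(h) ≤ C(1-r) always. Hence an inequality k S_p(h₁) ≤ S_p(h₂) with k < 1
can be improved to a larger k as soon as φ_p(k)h₁ ≤ h₂ without equality (`S_le_S_of_forall_smul`).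
This gives uniqueness and simplicity of the principal eigenpair; existence comes from maximizing t
subject to t w ≤ S_p(f₀ φ_p(w)) (`exists_eigen`).

By (H'), q(r,·) is non-increasing on ξ ≥ 0, strictly near (1,0), and q φ_p = f is non-decreasing for
small ξ ≥ 0. Small positive solutions therefore increase with λ (`OneSided.sol_le_sol`), and two of
them with equal σ coincide (`OneSided.sol_unique`). For λ slightly above λ₀, multiples of v₀ are
sub- and supersolutions; the solution between them is continuous in λ, and the intermediate value
theorem produces every small value σ(u) = s > 0 (`OneSided.eventually_exists_sol_sigma_eq`).
Negative s is handled with the kernel q(r,-ξ). Finally, compactness and simplicity show that every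
small non-trivial solution near (λ₀,0) is σ(u)(v₀ + z) with z small (`exists_normalized_mem`), so
nothing lies off the branch. -/

theorem phi_zero (q : ℝ) : phi q 0 = 0 := by simp [phi]

theorem phi_one (q : ℝ) : phi q 1 = 1 := by simp [phi]

theorem phi_neg (q x : ℝ) : phi q (-x) = -phi q x := by simp [phi]

theorem phi_mul (q a b : ℝ) : phi q (a * b) = phi q a * phi q b := by
  unfold phi
  rw [abs_mul, Real.mul_rpow (abs_nonneg _) (abs_nonneg _)]
  ring

theorem phi_pos {q x : ℝ} (hx : 0 < x) : 0 < phi q x := by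
  unfold phi
  have := Real.rpow_pos_of_pos (abs_pos.mpr hx.ne') (q - 2)
  positivity

theorem phi_nonneg {q x : ℝ} (hx : 0 ≤ x) : 0 ≤ phi q x := by
  unfold phi
  positivity

theorem phi_ne_zero {q x : ℝ} (hx : x ≠ 0) : phi q x ≠ 0 := by
  unfold phi
  exact mul_ne_zero (Real.rpow_pos_of_pos (abs_pos.mpr hx) _).ne' hx

theorem phi_strictMono {q : ℝ} (hq : 1 < q) : StrictMono (phi q) := by
  have hq' : 0 < q - 1 := by linarith
  have key : ∀ a b : ℝ, 0 ≤ a → a < b → phi q a < phi q b := fun a b ha hab => by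
    rw [phi_of_nonneg hq ha, phi_of_nonneg hq (ha.trans hab.le)]
    exact Real.rpow_lt_rpow ha hab hq'
  intro a b hab
  rcases le_or_gt 0 a with ha | ha
  · exact key a b ha hab
  · have h1 : phi q a < 0 := by
      have := phi_pos (q := q) (neg_pos.mpr ha)
      rw [phi_neg] at this
      linarith
    rcases le_or_gt 0 b with hb | hb
    · exact h1.trans_le (phi_nonneg hb)
    · have := key (-b) (-a) (by linarith) (by linarith)
      rw [phi_neg, phi_neg] at this
      linarith

theorem phi_mono {q : ℝ} (hq : 1 < q) : Monotone (phi q) := (phi_strictMono hq).monotone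

theorem phi_injective {q : ℝ} (hq : 1 < q) : Function.Injective (phi q) :=
  (phi_strictMono hq).injective

theorem abs_phi (q x : ℝ) : |phi q x| = phi q |x| := by
  unfold phi
  rw [abs_mul, abs_abs, abs_of_nonneg (by positivity : 0 ≤ |x| ^ (q - 2))]

theorem phi_conj_phi {p : ℝ} (hp : 1 < p) (x : ℝ) : phi (conj p) (phi p x) = x := by
  have key : ∀ x : ℝ, 0 ≤ x → phi (conj p) (phi p x) = x := fun x hx => by
    rw [phi_conj_of_nonneg hp (phi_nonneg hx), phi_of_nonneg hp hx, ← Real.rpow_mul hx,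
      mul_one_div_cancel (by linarith), Real.rpow_one]
  rcases le_total 0 x with hx | hx
  · exact key x hx
  · have := key (-x) (by linarith)
    rw [phi_neg, phi_neg] at this
    linarith

theorem phi_phi_conj {p : ℝ} (hp : 1 < p) (x : ℝ) : phi p (phi (conj p) x) = x :=
  phi_injective (one_lt_conj hp) (phi_conj_phi hp _)

theorem phi_mul_self {p : ℝ} (hp : 1 < p) (x : ℝ) : phi p x * x = |x| ^ p := by
  unfold phi
  rcases eq_or_ne x 0 with rfl | hx
  · simp [Real.zero_rpow (by linarith : p ≠ 0)]
  · have h : |x| ^ (p - 2) * x * x = |x| ^ (p - 2) * |x| ^ (2 : ℝ) := by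
      rw [mul_assoc, ← pow_two, ← sq_abs, ← Real.rpow_two]
    rw [h, ← Real.rpow_add (abs_pos.mpr hx)]
    congr 1
    ring

/-! ### Order and evaluation on `Y` -/

/-- Lets inequalities pass to limits in Y, as the maximization and iteration arguments require. -/
instance : OrderClosedTopology Y where
  isClosed_le' := by
    have h : {x : Y × Y | x.1 ≤ x.2} = ⋂ r, {x : Y × Y | x.1 r ≤ x.2 r} := by
      ext x
      simp [ContinuousMap.le_def]
    rw [h]
    exact isClosed_iInter fun r => isClosed_le
      ((continuous_eval_const r).comp continuous_fst)
      ((continuous_eval_const r).comp continuous_snd)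

theorem Phi_apply {q : ℝ} (hq : 1 < q) (g : Y) (r : unitInterval) : Phi hq g r = phi q (g r) := rfl

theorem nemytskii_apply (h : C(unitInterval × ℝ, ℝ)) (u : Y) (r : unitInterval) :
    nemytskii h u r = h (r, u r) := rfl

theorem continuous_Phi {q : ℝ} (hq : 1 < q) : Continuous (Phi hq) :=
  ContinuousMap.continuous_postcomp ⟨phi q, continuous_phi hq⟩

theorem continuous_nemytskii (h : C(unitInterval × ℝ, ℝ)) : Continuous (nemytskii h) := by
  refine ContinuousMap.continuous_of_continuous_uncurry _ ?_
  change Continuous fun x : Y × unitInterval => h (x.2, x.1 x.2)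
  fun_prop

theorem Phi_smul {q : ℝ} (hq : 1 < q) (c : ℝ) (g : Y) : Phi hq (c • g) = phi q c • Phi hq g := by
  ext r
  simp [Phi_apply, phi_mul]

theorem Phi_mono {q : ℝ} (hq : 1 < q) : Monotone (Phi hq) := fun _ _ hab r =>
  phi_mono hq (hab r)

theorem ext_of_mem (u : Y) {r : ℝ} (hr : r ∈ Icc (0 : ℝ) 1) : ext u r = u ⟨r, hr⟩ :=
  ext_coe u ⟨r, hr⟩

theorem ext_mono {a b : Y} (h : a ≤ b) (r : ℝ) : ext a r ≤ ext b r := h _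

theorem norm_ext_le (u : Y) (r : ℝ) : ‖ext u r‖ ≤ ‖u‖ := u.norm_coe_le_norm _

theorem ext_sub (a b : Y) (r : ℝ) : ext (a - b) r = ext a r - ext b r := rfl

theorem ext_smul (c : ℝ) (a : Y) (r : ℝ) : ext (c • a) r = c * ext a r := rfl

/-! ### The operator `J` -/

theorem continuous_J_integrand (N : ℕ) (h : Y) (s : ℝ) :
    Continuous fun t => (t / s) ^ (N - 1) * ext h t :=
  ((continuous_id.div_const _).pow _).mul (continuous_ext h)

theorem J_sub (N : ℕ) (a b : Y) (s : ℝ) : J N (a - b) s = J N a s - J N b s := by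
  unfold J
  rw [← intervalIntegral.integral_sub ((continuous_J_integrand N a s).intervalIntegrable _ _)
    ((continuous_J_integrand N b s).intervalIntegrable _ _)]
  simp only [ext_sub, mul_sub]

theorem J_smul (N : ℕ) (c : ℝ) (a : Y) (s : ℝ) : J N (c • a) s = c * J N a s := by
  unfold J
  rw [← intervalIntegral.integral_const_mul]
  simp only [ext_smul, mul_left_comm]

theorem J_nonneg (N : ℕ) {a : Y} (ha : 0 ≤ a) {s : ℝ} (hs : 0 ≤ s) : 0 ≤ J N a s := by
  refine intervalIntegral.integral_nonneg hs fun t ht => ?_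
  exact mul_nonneg (pow_nonneg (div_nonneg ht.1 hs) _) (ext_mono ha t)

theorem J_mono (N : ℕ) {a b : Y} (h : a ≤ b) {s : ℝ} (hs : 0 ≤ s) : J N a s ≤ J N b s := by
  have := J_nonneg N (sub_nonneg.mpr h) hs
  rw [J_sub] at this
  linarith

theorem abs_J_le (N : ℕ) (h : Y) {s : ℝ} (hs : s ∈ Icc (0 : ℝ) 1) : |J N h s| ≤ ‖h‖ := by
  have h1 : ∀ t ∈ uIoc 0 s, ‖(t / s) ^ (N - 1) * ext h t‖ ≤ ‖h‖ := fun t ht => by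
    rw [uIoc_of_le hs.1] at ht
    have h0 : 0 ≤ t / s := div_nonneg ht.1.le hs.1
    rw [norm_mul, Real.norm_of_nonneg (pow_nonneg h0 _)]
    calc (t / s) ^ (N - 1) * ‖ext h t‖ ≤ 1 * ‖h‖ :=
          mul_le_mul (pow_le_one₀ h0 (div_le_one_of_le₀ ht.2 hs.1)) (norm_ext_le h t)
            (norm_nonneg _) zero_le_one
      _ = ‖h‖ := one_mul _
  have h2 := intervalIntegral.norm_integral_le_of_norm_le_const h1
  rw [sub_zero, abs_of_nonneg hs.1] at h2
  exact h2.trans (mul_le_of_le_one_right (norm_nonneg _) hs.2)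

/-- `J(h)` is positive near `1` if `h ≥ 0` does not vanish identically. -/
theorem exists_J_pos (N : ℕ) {a : Y} (ha : 0 ≤ a) (h0 : a ≠ 0) :
    ∃ s₀ ∈ Ico (0 : ℝ) 1, ∀ s ∈ Icc s₀ 1, 0 < J N a s := by
  obtain ⟨t₁, ht₁, hpos⟩ : ∃ t ∈ Ioo (0 : ℝ) 1, 0 < ext a t := by
    by_contra! hcon
    have hcl : ∀ t ∈ closure (Ioo (0 : ℝ) 1), ext a t ≤ 0 := fun t ht =>
      le_on_closure (f := ext a) (g := fun _ => 0) hcon (continuous_ext a).continuousOn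
        continuousOn_const ht
    rw [closure_Ioo zero_ne_one] at hcl
    refine h0 (le_antisymm (fun r => ?_) ha)
    have := hcl r r.2
    rwa [ext_coe] at this
  have hcont := continuous_ext a
  obtain ⟨δ, hδ, hδ'⟩ := Metric.mem_nhds_iff.mp (hcont.continuousAt.eventually_const_lt hpos)
  obtain ⟨s₀, hs₀, hs₁⟩ : ∃ s₀, t₁ < s₀ ∧ s₀ < min (t₁ + δ) 1 :=
    exists_between (lt_min (by linarith) ht₁.2)
  have hs₁1 := hs₁.trans_le (min_le_right _ _)
  have hs₁2 := hs₁.trans_le (min_le_left _ _)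
  -- Since t₁ < s₀, each interval [0,s] with s ≥ s₀ contains t₁, where the integrand is positive.
  refine ⟨s₀, ⟨by linarith [ht₁.1], hs₁1⟩, fun s hs => ?_⟩
  have hspos : 0 < s := ht₁.1.trans (hs₀.trans_le hs.1)
  have hc := continuous_J_integrand N a s
  have hnn : ∀ t ∈ Icc (0 : ℝ) s, 0 ≤ (t / s) ^ (N - 1) * ext a t := fun t ht =>
    mul_nonneg (pow_nonneg (div_nonneg ht.1 hspos.le) _) (ext_mono ha t)
  refine intervalIntegral.integral_pos hspos hc.continuousOn
    (fun t ht => hnn t ⟨ht.1.le, ht.2⟩) ⟨t₁, ⟨ht₁.1.le, (hs₀.trans_le hs.1).le⟩, ?_⟩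
  exact mul_pos (pow_pos (div_pos ht₁.1 hspos) _) hpos

/-! ### The operator `S_p` -/

section operator

variable (N : ℕ) {p : ℝ} (hp : 1 < p)

/-- The continuous function `φ_{p'}(J(h))`, that is `-S_p(h)'`. -/
def flux (h : Y) : Y := Phi (one_lt_conj hp) ⟨fun s => J N h s, (continuous_J N h).comp
  continuous_subtype_val⟩

theorem flux_apply (h : Y) (s : unitInterval) : flux N hp h s = phi (conj p) (J N h s) := rfl

theorem flux_mono : Monotone (flux N hp) := fun _ _ hab s =>
  phi_mono (one_lt_conj hp) (J_mono N hab s.2.1)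

/-- `J` is linear and does not increase the sup norm on [0,1], and the Nemytskii operator of φ_{p'}
is continuous. -/
theorem continuous_flux : Continuous (flux N hp) := by
  refine (continuous_Phi _).comp ?_
  refine LipschitzWith.continuous (K := 1) (LipschitzWith.of_dist_le_mul fun a b => ?_)
  rw [NNReal.coe_one, one_mul, ContinuousMap.dist_le dist_nonneg]
  intro s
  have := abs_J_le N (a - b) s.2
  rw [J_sub] at this
  rwa [Real.dist_eq, dist_eq_norm]

theorem norm_flux_le (h : Y) : ‖flux N hp h‖ ≤ phi (conj p) ‖h‖ := by
  rw [ContinuousMap.norm_le _ (phi_nonneg (norm_nonneg _))]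
  intro s
  rw [flux_apply, Real.norm_eq_abs, abs_phi]
  exact phi_mono (one_lt_conj hp) (abs_J_le N h s.2)

theorem S_apply (h : Y) (r : unitInterval) :
    S N hp h r = ∫ s in (r : ℝ)..1, ext (flux N hp h) s := by
  refine intervalIntegral.integral_congr fun s hs => ?_
  rw [uIcc_of_le r.2.2] at hs
  have hs' : s ∈ Icc (0 : ℝ) 1 := ⟨r.2.1.trans hs.1, hs.2⟩
  simp only [ext_of_mem _ hs', flux_apply]

theorem S_apply_one (h : Y) : S N hp h 1 = 0 := by
  rw [S_apply]
  simp

theorem S_sub_apply (a b : Y) (r : unitInterval) : S N hp a r - S N hp b r =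
    ∫ s in (r : ℝ)..1, ext (flux N hp a - flux N hp b) s := by
  rw [S_apply, S_apply, ← intervalIntegral.integral_sub
    ((continuous_ext _).intervalIntegrable _ _) ((continuous_ext _).intervalIntegrable _ _)]
  rfl

/-- The factor 1 - r records the vanishing at the boundary; it matches the lower bounds c(1 - r), so
that functions can be compared up to r = 1. -/
theorem abs_S_sub_le (a b : Y) (r : unitInterval) :
    |S N hp a r - S N hp b r| ≤ ‖flux N hp a - flux N hp b‖ * (1 - r) := by
  rw [S_sub_apply]
  have := intervalIntegral.norm_integral_le_of_norm_le_const (a := (r : ℝ)) (b := 1)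
    fun t _ => norm_ext_le (flux N hp a - flux N hp b) t
  rwa [abs_of_nonneg (by linarith [r.2.2]), Real.norm_eq_abs] at this

theorem S_smul (c : ℝ) (h : Y) : S N hp (c • h) = phi (conj p) c • S N hp h := by
  have h1 : flux N hp (c • h) = phi (conj p) c • flux N hp h := by
    ext s
    simp only [flux_apply, J_smul, phi_mul, ContinuousMap.smul_apply, smul_eq_mul]
  ext r
  simp only [S_apply, h1, ext_smul, ContinuousMap.smul_apply, smul_eq_mul,
    intervalIntegral.integral_const_mul]

theorem S_phi_smul (c : ℝ) (h : Y) : S N hp (phi p c • h) = c • S N hp h := by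
  rw [S_smul, phi_conj_phi hp]

theorem S_zero : S N hp 0 = 0 := by
  have := S_smul N hp 0 0
  rwa [phi_zero, zero_smul, zero_smul] at this

theorem abs_S_apply_le (h : Y) (r : unitInterval) :
    |S N hp h r| ≤ phi (conj p) ‖h‖ * (1 - r) := by
  have h0 : flux N hp 0 = 0 := by
    have := norm_flux_le N hp 0
    rwa [norm_zero, phi_zero, norm_le_zero_iff] at this
  have h1 := abs_S_sub_le N hp h 0 r
  rw [S_zero, h0, ContinuousMap.zero_apply, sub_zero, sub_zero] at h1
  exact h1.trans (mul_le_mul_of_nonneg_right (norm_flux_le N hp h) (by linarith [r.2.2]))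

/-- Near `h₀`, `S_p(h)` is close to `S_p(h₀)` even relative to the distance to the boundary. -/
theorem eventually_abs_S_sub_le (h₀ : Y) {ε : ℝ} (hε : 0 < ε) :
    ∀ᶠ h in 𝓝 h₀, ∀ r, |S N hp h r - S N hp h₀ r| ≤ ε * (1 - r) := by
  have h1 := (continuous_flux N hp).tendsto h₀ (Metric.ball_mem_nhds _ hε)
  filter_upwards [h1] with h hh r
  rw [mem_preimage, mem_ball_iff_norm] at hh
  exact (abs_S_sub_le N hp h h₀ r).trans
    (mul_le_mul_of_nonneg_right hh.le (by linarith [r.2.2]))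

theorem continuous_S : Continuous (S N hp) := by
  refine continuous_iff_continuousAt.mpr fun h₀ => Metric.tendsto_nhds.mpr fun ε hε => ?_
  filter_upwards [eventually_abs_S_sub_le N hp h₀ (half_pos hε)] with h hh
  refine lt_of_le_of_lt ((ContinuousMap.dist_le (half_pos hε).le).mpr fun r => ?_)
    (half_lt_self hε)
  rw [Real.dist_eq]
  exact (hh r).trans (mul_le_of_le_one_right (half_pos hε).le (by linarith [r.2.1]))

theorem S_mono : Monotone (S N hp) := fun a b hab r => by
  have h1 : 0 ≤ S N hp b r - S N hp a r := by
    rw [S_sub_apply]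
    refine intervalIntegral.integral_nonneg r.2.2 fun s _ => ?_
    exact ext_mono (sub_nonneg.mpr (flux_mono N hp hab)) s
  exact sub_nonneg.mp h1

theorem S_nonneg {h : Y} (hh : 0 ≤ h) : 0 ≤ S N hp h := by
  have := S_mono N hp hh
  rwa [S_zero] at this

/-- Strong monotonicity of `S_p`. -/
theorem exists_le_S_sub {a b : Y} (hab : a ≤ b) (hne : a ≠ b) :
    ∃ c > 0, ∀ r : unitInterval, c * (1 - r) ≤ S N hp b r - S N hp a r := by
  obtain ⟨s₀, hs₀, hJ⟩ := exists_J_pos N (sub_nonneg.mpr hab) (sub_ne_zero.mpr hne.symm)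
  set w : Y := flux N hp b - flux N hp a with hw
  have hw0 : 0 ≤ w := sub_nonneg.mpr (flux_mono N hp hab)
  have hwpos : ∀ s ∈ Icc s₀ 1, 0 < ext w s := fun s hs => by
    have hs' : s ∈ Icc (0 : ℝ) 1 := ⟨hs₀.1.trans hs.1, hs.2⟩
    rw [ext_of_mem _ hs', hw, ContinuousMap.sub_apply, flux_apply, flux_apply, sub_pos]
    refine phi_strictMono (one_lt_conj hp) ?_
    have := hJ s hs
    rw [J_sub] at this
    linarith
  obtain ⟨s₁, hs₁, hmin⟩ := isCompact_Icc.exists_isMinOn (nonempty_Icc.mpr hs₀.2.le)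
    (continuous_ext w).continuousOn
  set m := ext w s₁
  have hm : 0 < m := hwpos s₁ hs₁
  have hmle : ∀ s ∈ Icc s₀ 1, m ≤ ext w s := fun s hs => hmin hs
  have hint : ∀ x y : ℝ, IntervalIntegrable (ext w) MeasureTheory.volume x y := fun x y =>
    (continuous_ext w).intervalIntegrable x y
  have hlow : ∀ x ∈ Icc s₀ 1, m * (1 - x) ≤ ∫ s in x..1, ext w s := fun x hx => by
    have h1 : ∫ _ in x..1, m ≤ ∫ s in x..1, ext w s :=
      intervalIntegral.integral_mono_on hx.2 (by simp) (hint _ _)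
        fun s hs => hmle s ⟨hx.1.trans hs.1, hs.2⟩
    rw [intervalIntegral.integral_const, smul_eq_mul] at h1
    linarith
  -- For r ≥ s₀ the rate m works; for r ≤ s₀ only the integral over [s₀,1] is kept, which costs the
  -- factor 1 - s₀.
  refine ⟨m * (1 - s₀), mul_pos hm (by linarith [hs₀.2]), fun r => ?_⟩
  rw [S_sub_apply, ← hw]
  have hr0 := r.2.1
  have hr1 := r.2.2
  rcases le_total s₀ r with h | h
  · refine le_trans ?_ (hlow r ⟨h, r.2.2⟩)
    exact mul_le_mul_of_nonneg_right (mul_le_of_le_one_right hm.le (by linarith [hs₀.1]))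
      (by linarith)
  · rw [← intervalIntegral.integral_add_adjacent_intervals (hint r s₀) (hint s₀ 1)]
    have h1 : 0 ≤ ∫ s in (r : ℝ)..s₀, ext w s :=
      intervalIntegral.integral_nonneg h fun s _ => ext_mono hw0 s
    have h2 := hlow s₀ ⟨le_rfl, hs₀.2.le⟩
    have h3 : m * (1 - s₀) * (1 - r) ≤ m * (1 - s₀) :=
      mul_le_of_le_one_right (mul_nonneg hm.le (by linarith [hs₀.2])) (by linarith)
    linarith

theorem exists_le_S {h : Y} (hh : 0 ≤ h) (h0 : h ≠ 0) :
    ∃ c > 0, ∀ r : unitInterval, c * (1 - r) ≤ S N hp h r := by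
  obtain ⟨c, hc, H⟩ := exists_le_S_sub N hp hh h0.symm
  refine ⟨c, hc, fun r => ?_⟩
  have := H r
  rwa [S_zero, ContinuousMap.zero_apply, sub_zero] at this

theorem S_ne_zero {h : Y} (hh : 0 ≤ h) (h0 : h ≠ 0) : S N hp h ≠ 0 := by
  obtain ⟨c, hc, H⟩ := exists_le_S N hp hh h0
  intro h1
  have := H 0
  rw [h1] at this
  simp at this
  linarith

/-- If `h ≥ 0` does not vanish, then `S_p` is non-negative near `h`. -/
theorem eventually_S_nonneg {h₀ : Y} (hh : 0 ≤ h₀) (h0 : h₀ ≠ 0) :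
    ∀ᶠ h in 𝓝 h₀, 0 ≤ S N hp h := by
  obtain ⟨c, hc, H⟩ := exists_le_S N hp hh h0
  filter_upwards [eventually_abs_S_sub_le N hp h₀ hc] with h hh r
  have h1 := (abs_le.mp (hh r)).1
  have h2 := H r
  change 0 ≤ S N hp h r
  linarith

/-- `S_p` maps balls to relatively compact sets. -/
theorem isCompact_closure_S_image (R : ℝ) :
    IsCompact (closure (S N hp '' Metric.closedBall 0 R)) := by
  set e := ContinuousMap.isometryEquivBoundedOfCompact unitInterval ℝ
  set M := phi (conj p) R
  have hflux : ∀ h ∈ Metric.closedBall (0 : Y) R, ‖flux N hp h‖ ≤ M := fun h hh =>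
    (norm_flux_le N hp h).trans
      (phi_mono (one_lt_conj hp) (by rwa [mem_closedBall_zero_iff] at hh))
  have h1 : IsCompact (closure (e '' (S N hp '' Metric.closedBall 0 R))) := by
    refine BoundedContinuousFunction.arzela_ascoli (Icc (-M) M) isCompact_Icc _ ?_ ?_
    · rintro _ r ⟨_, ⟨h, hh, rfl⟩, rfl⟩
      have h2 := abs_S_apply_le N hp h r
      have h3 : phi (conj p) ‖h‖ ≤ M :=
        phi_mono (one_lt_conj hp) (by rwa [mem_closedBall_zero_iff] at hh)
      have h4 : phi (conj p) ‖h‖ * (1 - r) ≤ phi (conj p) ‖h‖ :=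
        mul_le_of_le_one_right (phi_nonneg (norm_nonneg _)) (by linarith [r.2.1])
      exact abs_le.mp (h2.trans (h4.trans h3))
    · refine Metric.equicontinuous_of_continuity_modulus (fun d => M * d) ?_ _ ?_
      · have : Continuous fun d : ℝ => M * d := by fun_prop
        simpa using this.tendsto 0
      · rintro x y ⟨_, ⟨_, ⟨h, hh, rfl⟩, rfl⟩⟩
        have hi : ∀ a b : ℝ, IntervalIntegrable (ext (flux N hp h)) MeasureTheory.volume a b :=
          fun a b => (continuous_ext _).intervalIntegrable a b
        change dist (S N hp h x) (S N hp h y) ≤ M * dist x y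
        rw [Real.dist_eq, S_apply, S_apply,
          intervalIntegral.integral_interval_sub_interval_comm (hi _ _) (hi _ _) (hi _ _),
          intervalIntegral.integral_same, sub_zero, dist_comm, Subtype.dist_eq, Real.dist_eq]
        exact intervalIntegral.norm_integral_le_of_norm_le_const
          fun t _ => (norm_ext_le _ t).trans (hflux h hh)
  rw [← e.toHomeomorph.isCompact_image, e.toHomeomorph.image_closure]
  exact h1

/-- Comparison principle. -/
theorem S_le_S_of_forall_smul {h₁ h₂ : Y} (hh : 0 ≤ h₂) (h0 : h₂ ≠ 0)
    (H : ∀ k ∈ Ioo (0 : ℝ) 1, k • S N hp h₁ ≤ S N hp h₂ → phi p k • h₁ ≤ h₂ ∧ phi p k • h₁ ≠ h₂) :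
    S N hp h₁ ≤ S N hp h₂ := by
  -- The summand 1 only keeps C positive when `h₁` is zero.
  set C := phi (conj p) ‖h₁‖ + 1
  have hC : 0 < C := by
    have := phi_nonneg (q := conj p) (norm_nonneg h₁)
    linarith
  have hup : ∀ r : unitInterval, S N hp h₁ r ≤ C * (1 - r) := fun r =>
    (le_abs_self _).trans ((abs_S_apply_le N hp h₁ r).trans
      (mul_le_mul_of_nonneg_right (by linarith) (by linarith [r.2.2])))
  have hstep : ∀ (c : ℝ) (r : unitInterval), 0 < c → min (c / C) 1 * S N hp h₁ r ≤ c * (1 - r) :=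
    fun c r hc => by
      have hr : 0 ≤ 1 - (r : ℝ) := by linarith [r.2.2]
      calc min (c / C) 1 * S N hp h₁ r ≤ min (c / C) 1 * (C * (1 - r)) :=
            mul_le_mul_of_nonneg_left (hup r) (by positivity)
        _ ≤ c / C * (C * (1 - r)) :=
            mul_le_mul_of_nonneg_right (min_le_left _ _) (mul_nonneg hC.le hr)
        _ = c * (1 - r) := by field_simp
  -- Take the largest admissible k. If it were below 1, `H` and strong monotonicity would leave a
  -- gap d(1 - r), and a larger k would be admissible.
  set K : Set ℝ := {k ∈ Icc (0 : ℝ) 1 | k • S N hp h₁ ≤ S N hp h₂}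
  have hK : IsCompact K := isCompact_Icc.inter_right
    (isClosed_le (f := fun k : ℝ => k • S N hp h₁) (by fun_prop) continuous_const)
  obtain ⟨c, hc, hlow⟩ := exists_le_S N hp hh h0
  have hk₀ : min (c / C) 1 ∈ K :=
    ⟨⟨by positivity, min_le_right _ _⟩, fun r => (hstep c r hc).trans (hlow r)⟩
  obtain ⟨k, hk, hmax⟩ := hK.exists_isGreatest ⟨_, hk₀⟩
  have hkpos : 0 < k := lt_of_lt_of_le (by positivity) (hmax hk₀)
  rcases hk.1.2.eq_or_lt with rfl | hk1
  · simpa using hk.2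
  exfalso
  obtain ⟨h1, h2⟩ := H k ⟨hkpos, hk1⟩ hk.2
  obtain ⟨d, hd, hdl⟩ := exists_le_S_sub N hp h1 h2
  rw [S_phi_smul] at hdl
  set m := min (min (d / C) 1) (1 - k)
  have hm : 0 < m := lt_min (by positivity) (by linarith)
  have hmem : k + m ∈ K := by
    refine ⟨⟨by linarith, by linarith [min_le_right (min (d / C) 1) (1 - k)]⟩, fun r => ?_⟩
    have hr : 0 ≤ 1 - (r : ℝ) := by linarith [r.2.2]
    have h3 := hdl r
    simp only [ContinuousMap.smul_apply, smul_eq_mul] at h3 ⊢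
    have h4 : m * S N hp h₁ r ≤ d * (1 - r) := by
      rcases le_total (S N hp h₁ r) 0 with h | h
      · exact (mul_nonpos_of_nonneg_of_nonpos hm.le h).trans (mul_nonneg hd.le hr)
      · exact (mul_le_mul_of_nonneg_right (min_le_left _ _) h).trans (hstep d r hd)
    change (k + m) * S N hp h₁ r ≤ S N hp h₂ r
    linarith
  linarith [hmax hmem]

end operator

/-! ### The differential equation and the integral equation -/

theorem pow_mul_J (N : ℕ) (h : Y) {s : ℝ} (hs : s ≠ 0) :
    s ^ (N - 1) * J N h s = ∫ t in (0 : ℝ)..s, t ^ (N - 1) * ext h t := by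
  rw [J, ← intervalIntegral.integral_const_mul]
  congr 1
  funext t
  rw [← mul_assoc, ← mul_pow, mul_div_cancel₀ _ hs]

theorem hasDerivAt_integral_pow (N : ℕ) (h : Y) (s : ℝ) :
    HasDerivAt (fun s => ∫ t in (0 : ℝ)..s, t ^ (N - 1) * ext h t) (s ^ (N - 1) * ext h s) s := by
  have hc : Continuous fun t => t ^ (N - 1) * ext h t := (continuous_id.pow _).mul (continuous_ext h)
  exact intervalIntegral.integral_hasDerivAt_right (hc.intervalIntegrable _ _)
    (hc.stronglyMeasurableAtFilter _ _) hc.continuousAt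

/-- The mean `∫₀¹ τ^(N-1) h(sτ) dτ`. -/
def meanJ (N : ℕ) (h : Y) (s : ℝ) : ℝ := ∫ τ in (0 : ℝ)..1, τ ^ (N - 1) * ext h (s * τ)

theorem continuous_meanJ (N : ℕ) (h : Y) : Continuous (meanJ N h) := by
  have h2 := continuous_ext h
  refine intervalIntegral.continuous_parametric_intervalIntegral_of_continuous' ?_ 0 1
  exact (continuous_snd.pow _).mul (h2.comp (continuous_fst.mul continuous_snd))

/-- Away from 0 this is the quotient rule for s^(-(N-1)) ∫₀ˢ t^(N-1) h dt. At 0 the slopes of `J`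
are the values of `meanJ`, and meanJ(0) = h(0)/((N-1)+1) makes the same formula valid. -/
theorem hasDerivAt_J (N : ℕ) (h : Y) (s : ℝ) :
    HasDerivAt (J N h) (ext h s - (N - 1 : ℕ) * meanJ N h s) s := by
  rcases eq_or_ne s 0 with rfl | hs
  · have h1 : meanJ N h 0 = ext h 0 / ((N - 1 : ℕ) + 1) := by
      simp only [meanJ, zero_mul, intervalIntegral.integral_mul_const, integral_pow]
      simp
      ring
    have h2 : ext h 0 - (N - 1 : ℕ) * meanJ N h 0 = meanJ N h 0 := by
      have : ((N - 1 : ℕ) : ℝ) + 1 ≠ 0 := by positivity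
      rw [h1]
      field_simp
      ring
    rw [h2, hasDerivAt_iff_tendsto_slope]
    refine ((continuous_meanJ N h).tendsto 0).mono_left nhdsWithin_le_nhds |>.congr' ?_
    filter_upwards [self_mem_nhdsWithin] with t ht
    have ht' : t ≠ 0 := ht
    rw [slope_def_field, J_eq, J_eq, zero_mul, sub_zero, sub_zero, meanJ, mul_div_cancel_left₀ _ ht']
  · have h1 : HasDerivAt (fun s => (∫ t in (0 : ℝ)..s, t ^ (N - 1) * ext h t) / s ^ (N - 1))
        (ext h s - (N - 1 : ℕ) * meanJ N h s) s := by
      refine HasDerivAt.congr_deriv ((hasDerivAt_integral_pow N h s).div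
        (hasDerivAt_pow (N - 1) s) (pow_ne_zero _ hs)) ?_
      rw [← pow_mul_J N h hs, J_eq, ← meanJ]
      -- The derivative of s^(N-1) carries the truncated exponent N - 1 - 1, so the case N - 1 = 0
      -- is separate.
      rcases Nat.eq_zero_or_pos (N - 1) with h0 | h0
      · simp [h0]
      · obtain ⟨k, hk⟩ := Nat.exists_eq_succ_of_ne_zero h0.ne'
        rw [hk]
        simp only [Nat.succ_eq_add_one, Nat.add_sub_cancel]
        field_simp
        ring
    refine h1.congr_of_eventuallyEq ?_
    filter_upwards [isOpen_ne.mem_nhds hs] with t ht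
    rw [← pow_mul_J N h ht, mul_div_cancel_left₀ _ (pow_ne_zero _ ht)]

theorem contDiff_J (N : ℕ) (h : Y) : ContDiff ℝ 1 (J N h) := by
  rw [contDiff_one_iff_deriv]
  refine ⟨fun s => (hasDerivAt_J N h s).differentiableAt, ?_⟩
  rw [show deriv (J N h) = _ from funext fun s => (hasDerivAt_J N h s).deriv]
  exact (continuous_ext h).sub (continuous_const.mul (continuous_meanJ N h))

section operator

variable (N : ℕ) {p : ℝ} (hp : 1 < p)

theorem ext_S {h : Y} {r : ℝ} (hr : r ∈ Icc (0 : ℝ) 1) :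
    ext (S N hp h) r = ∫ s in r..1, phi (conj p) (J N h s) := ext_of_mem _ hr

theorem continuous_phi_J (hp : 1 < p) (h : Y) :
    Continuous fun s => phi (conj p) (J N h s) :=
  (continuous_phi (one_lt_conj hp)).comp (continuous_J N h)

theorem hasDerivWithinAt_S (h : Y) {r : ℝ} (hr : r ∈ Icc (0 : ℝ) 1) :
    HasDerivWithinAt (ext (S N hp h)) (-phi (conj p) (J N h r)) (Icc 0 1) r := by
  have hc := continuous_phi_J N hp h
  have h1 := intervalIntegral.integral_hasDerivAt_left (hc.intervalIntegrable r 1)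
    (hc.stronglyMeasurableAtFilter _ _) hc.continuousAt
  exact h1.hasDerivWithinAt.congr (fun s hs => ext_S N hp hs) (ext_S N hp hr)

theorem D_S (h : Y) {r : ℝ} (hr : r ∈ Icc (0 : ℝ) 1) :
    D (S N hp h) r = -phi (conj p) (J N h r) :=
  (hasDerivWithinAt_S N hp h hr).derivWithin (uniqueDiffOn_Icc_zero_one r hr)

theorem phi_D_S (h : Y) {r : ℝ} (hr : r ∈ Icc (0 : ℝ) 1) :
    phi p (D (S N hp h) r) = -J N h r := by
  rw [D_S N hp h hr, phi_neg, phi_phi_conj hp]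

theorem memX_S (h : Y) : MemX p (S N hp h) := by
  refine ⟨?_, ?_, ?_, S_apply_one N hp h⟩
  · rw [show (1 : WithTop ℕ∞) = 0 + 1 from rfl,
      contDiffOn_succ_iff_derivWithin uniqueDiffOn_Icc_zero_one]
    refine ⟨fun r hr => (hasDerivWithinAt_S N hp h hr).differentiableWithinAt, by simp, ?_⟩
    rw [contDiffOn_zero]
    exact (continuous_phi_J N hp h).neg.continuousOn.congr fun r hr => D_S N hp h hr
  · exact (contDiff_J N h).neg.contDiffOn.congr fun r hr => phi_D_S N hp h hr
  · rw [D_S N hp h ⟨le_rfl, zero_le_one⟩, J_eq, zero_mul, phi_zero, neg_zero]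

theorem neg_deriv_pow_mul_phi_D_S (h : Y) {r : ℝ} (hr : r ∈ Ioo (0 : ℝ) 1) :
    -deriv (fun s => s ^ (N - 1) * phi p (D (S N hp h) s)) r = r ^ (N - 1) * ext h r := by
  have h1 : (fun s => s ^ (N - 1) * phi p (D (S N hp h) s)) =ᶠ[𝓝 r]
      fun s => -∫ t in (0 : ℝ)..s, t ^ (N - 1) * ext h t := by
    filter_upwards [isOpen_Ioo.mem_nhds hr] with s hs
    rw [phi_D_S N hp h (Ioo_subset_Icc_self hs), mul_neg, pow_mul_J N h hs.1.ne']
  rw [h1.deriv_eq, deriv.fun_neg, (hasDerivAt_integral_pow N h r).deriv, neg_neg]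

/-- A solution of the boundary value problem `-(r^(N-1) φ_p(v'))' = r^(N-1) h`, `v'(0) = v(1) = 0`
is `S_p(h)`. -/
theorem eq_S_of_memX {v h : Y} (hv : MemX p v)
    (heq : ∀ r ∈ Ioo (0 : ℝ) 1,
      -deriv (fun s => s ^ (N - 1) * phi p (D v s)) r = r ^ (N - 1) * ext h r) :
    v = S N hp h := by
  obtain ⟨h1, h2, h3, h4⟩ := hv
  have hc : Continuous fun t => t ^ (N - 1) * ext h t := (continuous_id.pow _).mul (continuous_ext h)
  have hD : ∀ r ∈ Ioo (0 : ℝ) 1, HasDerivAt (ext v) (D v r) r := fun r hr =>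
    (((h1.differentiableOn one_ne_zero) r (Ioo_subset_Icc_self hr)).hasDerivWithinAt).hasDerivAt
      (Icc_mem_nhds hr.1 hr.2)
  have hg : ∀ r ∈ Ioo (0 : ℝ) 1, HasDerivAt (fun s => s ^ (N - 1) * phi p (D v s))
      (-(r ^ (N - 1) * ext h r)) r := fun r hr => by
    rw [← heq r hr, neg_neg]
    refine DifferentiableAt.hasDerivAt ?_
    refine (differentiableAt_pow (N - 1)).mul ?_
    exact ((h2.differentiableOn one_ne_zero) r (Ioo_subset_Icc_self hr)).differentiableAt
      (Icc_mem_nhds hr.1 hr.2)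
  -- Integrate the equation from 0. The boundary term vanishes because v'(0) = 0; for N = 1 the
  -- factor s^(N-1) would not remove it.
  have hflux : ∀ r ∈ Ioc (0 : ℝ) 1, phi (conj p) (J N h r) = -D v r := fun r hr => by
    have hsub : Icc (0 : ℝ) r ⊆ Icc 0 1 := Icc_subset_Icc_right hr.2
    have h5 := intervalIntegral.integral_eq_sub_of_hasDerivAt_of_le hr.1.le
      ((continuousOn_id.pow (N - 1)).mul (h2.continuousOn.mono hsub))
      (fun s hs => hg s ⟨hs.1, hs.2.trans_le hr.2⟩) (hc.neg.intervalIntegrable _ _)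
    simp only [Pi.mul_apply, Pi.pow_apply, id_eq, h3, phi_zero, mul_zero, sub_zero,
      intervalIntegral.integral_neg] at h5
    rw [← pow_mul_J N h hr.1.ne', ← mul_neg] at h5
    have h6 := mul_left_cancel₀ (pow_ne_zero _ hr.1.ne') h5
    rw [← neg_eq_iff_eq_neg.mpr h6.symm, phi_neg, phi_conj_phi hp]
  ext r
  have hr := r.2
  have h5 := intervalIntegral.integral_eq_sub_of_hasDerivAt_of_le hr.2
    (continuous_ext v).continuousOn
    (fun s hs => by
      have hs' : s ∈ Ioo (0 : ℝ) 1 := ⟨hr.1.trans_lt hs.1, hs.2⟩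
      have := hD s hs'
      rwa [← neg_eq_iff_eq_neg.mpr (hflux s ⟨hs'.1, hs'.2.le⟩)] at this)
    ((continuous_phi_J N hp h).neg.intervalIntegrable _ _)
  simp only [Pi.neg_apply, intervalIntegral.integral_neg] at h5
  rw [← ext_S N hp hr, ext_coe, ext_coe] at h5
  have h6 : ext v 1 = 0 := (ext_coe v 1).trans h4
  rw [h6] at h5
  linarith

variable {N}

/-- Replaces the differential equation by a fixed-point equation for S_p, to which the order
arguments apply. -/
theorem isPrincipal_iff {f₀ v : Y} {lam : ℝ} : IsPrincipal N p f₀ lam v ↔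
    v = S N hp (lam • (f₀ * Phi hp v)) ∧ (∀ r : unitInterval, (r : ℝ) < 1 → 0 < v r) ∧
    ∫ r in (0 : ℝ)..1, r ^ (N - 1) * ext f₀ r * |ext v r| ^ p = 1 := by
  have hh : ∀ r, r ^ (N - 1) * ext (lam • (f₀ * Phi hp v)) r =
      lam * r ^ (N - 1) * ext f₀ r * phi p (ext v r) := fun r => by
    rw [ext_smul]
    change r ^ (N - 1) * (lam * (ext f₀ r * phi p (ext v r))) = _
    ring
  constructor
  · rintro ⟨h1, h2, h3, h4⟩
    refine ⟨eq_S_of_memX N hp h1 fun r hr => ?_, h3, h4⟩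
    rw [h2 r hr, hh]
  · rintro ⟨h1, h3, h4⟩
    refine ⟨?_, fun r hr => ?_, h3, h4⟩
    · rw [h1]
      exact memX_S N hp _
    · rw [← hh, ← neg_deriv_pow_mul_phi_D_S N hp _ hr, ← h1]

end operator

section operator

variable (N : ℕ) {p : ℝ} (hp : 1 < p)

/-! ### The weighted functional defining `Z` -/

/-- `σ(u) = ∫₀¹ r^(N-1) f₀ φ_p(v₀) u dr`. -/
def sigma (f₀ v₀ u : Y) : ℝ := J N (f₀ * Phi hp v₀ * u) 1

theorem sigma_eq_integral (f₀ v₀ u : Y) : sigma N hp f₀ v₀ u =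
    ∫ r in (0 : ℝ)..1, r ^ (N - 1) * ext f₀ r * phi p (ext v₀ r) * ext u r := by
  unfold sigma J
  congr 1
  funext r
  change (r / 1) ^ (N - 1) * (ext f₀ r * phi p (ext v₀ r) * ext u r) = _
  rw [div_one]
  ring

theorem sigma_self (f₀ v : Y) : sigma N hp f₀ v v =
    ∫ r in (0 : ℝ)..1, r ^ (N - 1) * ext f₀ r * |ext v r| ^ p := by
  rw [sigma_eq_integral]
  simp only [mul_assoc, phi_mul_self hp]

theorem mem_Z_iff (f₀ v₀ z : Y) : z ∈ Z N hp f₀ v₀ ↔ sigma N hp f₀ v₀ z = 0 := by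
  rw [sigma_eq_integral]
  rfl

theorem sigma_sub (f₀ v₀ a b : Y) :
    sigma N hp f₀ v₀ (a - b) = sigma N hp f₀ v₀ a - sigma N hp f₀ v₀ b := by
  unfold sigma
  rw [mul_sub, J_sub]

theorem sigma_smul (f₀ v₀ : Y) (c : ℝ) (a : Y) :
    sigma N hp f₀ v₀ (c • a) = c * sigma N hp f₀ v₀ a := by
  unfold sigma
  rw [mul_smul_comm, J_smul]

theorem sigma_zero (f₀ v₀ : Y) : sigma N hp f₀ v₀ 0 = 0 := by
  have := sigma_smul N hp f₀ v₀ 0 0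
  rwa [zero_smul, zero_mul] at this

theorem continuous_sigma (f₀ v₀ : Y) : Continuous (sigma N hp f₀ v₀) := by
  refine LipschitzWith.continuous (K := ‖f₀ * Phi hp v₀‖₊) (LipschitzWith.of_dist_le_mul
    fun a b => ?_)
  rw [Real.dist_eq, dist_eq_norm, ← sigma_sub]
  exact (abs_J_le N _ ⟨zero_le_one, le_rfl⟩).trans (norm_mul_le _ _)

theorem Phi_nonneg {v : Y} (hv : 0 ≤ v) : 0 ≤ Phi hp v := fun r => phi_nonneg (hv r)

theorem sigma_mono {f₀ v₀ : Y} (hf₀ : 0 ≤ f₀) (hv₀ : 0 ≤ v₀) : Monotone (sigma N hp f₀ v₀) :=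
  fun _ _ hab => J_mono N (mul_le_mul_of_nonneg_left hab
    (mul_nonneg hf₀ (Phi_nonneg hp hv₀))) zero_le_one

/-- The weight f₀ φ_p(v₀) is known to be positive only for r < 1; as u(1) = 0, a non-zero u is seen
there. -/
theorem sigma_pos {f₀ v₀ u : Y} (hf₀ : ∀ r, 0 < f₀ r)
    (hv₀ : ∀ r : unitInterval, (r : ℝ) < 1 → 0 < v₀ r) (hu : 0 ≤ u) (hu0 : u ≠ 0) (hu1 : u 1 = 0) :
    0 < sigma N hp f₀ v₀ u := by
  have hne : ∀ r : unitInterval, r ≠ 1 → (r : ℝ) < 1 := fun r hr =>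
    lt_of_le_of_ne r.2.2 fun h => hr (Subtype.ext h)
  have h1 : 0 ≤ f₀ * Phi hp v₀ * u := fun r => by
    change 0 ≤ f₀ r * phi p (v₀ r) * u r
    rcases eq_or_ne r 1 with rfl | hr
    · rw [hu1, mul_zero]
    · exact mul_nonneg (mul_nonneg (hf₀ r).le (phi_nonneg (hv₀ r (hne r hr)).le)) (hu r)
  have h2 : f₀ * Phi hp v₀ * u ≠ 0 := fun h => hu0 <| by
    ext r
    rcases eq_or_ne r 1 with rfl | hr
    · exact hu1
    · have h3 : f₀ r * phi p (v₀ r) * u r = 0 := congrArg (fun y : Y => y r) h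
      exact (mul_eq_zero.mp h3).resolve_left
        (mul_pos (hf₀ r) (phi_pos (hv₀ r (hne r hr)))).ne'
  obtain ⟨s₀, hs₀, H⟩ := exists_J_pos N h1 h2
  exact H 1 ⟨hs₀.2.le, le_rfl⟩

/-! ### Eigenfunctions -/

theorem mul_Phi_smul (f₀ : Y) (c : ℝ) (w : Y) :
    f₀ * Phi hp (c • w) = phi p c • (f₀ * Phi hp w) := by
  rw [Phi_smul, mul_smul_comm]

theorem mul_Phi_mono {f₀ : Y} (hf₀ : ∀ r, 0 < f₀ r) : Monotone fun w => f₀ * Phi hp w :=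
  fun _ _ hab => mul_le_mul_of_nonneg_left (Phi_mono hp hab) fun r => (hf₀ r).le

theorem mul_Phi_injective {f₀ : Y} (hf₀ : ∀ r, 0 < f₀ r) :
    Function.Injective fun w => f₀ * Phi hp w := fun a b h => by
  ext r
  have h1 : f₀ r * phi p (a r) = f₀ r * phi p (b r) := congrArg (fun y : Y => y r) h
  exact phi_injective hp (mul_left_cancel₀ (hf₀ r).ne' h1)

theorem mul_Phi_zero (f₀ : Y) : f₀ * Phi hp 0 = 0 := by
  have := mul_Phi_smul hp f₀ 0 0
  rwa [phi_zero, zero_smul, zero_smul] at this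

theorem mul_Phi_nonneg {f₀ : Y} (hf₀ : ∀ r, 0 < f₀ r) {w : Y} (hw : 0 ≤ w) :
    0 ≤ f₀ * Phi hp w := by
  have := mul_Phi_mono hp hf₀ hw
  simpa only [mul_Phi_zero] using this

theorem mul_Phi_ne_zero {f₀ : Y} (hf₀ : ∀ r, 0 < f₀ r) {w : Y} (hw : w ≠ 0) :
    f₀ * Phi hp w ≠ 0 := fun h => hw <| mul_Phi_injective hp hf₀ <| by
  simpa only [mul_Phi_zero] using h

variable {N hp}

theorem pos_of_eigen {f₀ v : Y} (hf₀ : ∀ r, 0 < f₀ r) {lam : ℝ}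
    (hv : v = S N hp (lam • (f₀ * Phi hp v))) (hv0 : 0 ≤ v) (hne : v ≠ 0) : 0 < lam := by
  by_contra! h
  refine hne (le_antisymm ?_ hv0)
  rw [hv, S_smul]
  refine smul_nonpos_of_nonpos_of_nonneg ?_ (S_nonneg N hp (mul_Phi_nonneg hp hf₀ hv0))
  have := phi_mono (one_lt_conj hp) h
  rwa [phi_zero] at this

theorem eigen_smul {f₀ w : Y} {lam : ℝ} (hw : w = S N hp (lam • (f₀ * Phi hp w))) (c : ℝ) :
    c • w = S N hp (lam • (f₀ * Phi hp (c • w))) := by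
  rw [mul_Phi_smul, smul_comm, S_phi_smul, ← hw]

/-- Compare w with Mv for every M > 0. If kw ≤ Mv, then μ f₀ φ_p(kw) ≤ μ f₀ φ_p(Mv) ≤ λ f₀ φ_p(Mv),
and equality would force kw = Mv. So either w is a positive multiple of v, or w ≤ Mv for all M > 0,
and M → 0 gives w ≤ 0. -/
theorem eigen_nonpos_or_eq_smul {f₀ v w : Y} (hf₀ : ∀ r, 0 < f₀ r) {lam mu : ℝ}
    (hv : v = S N hp (lam • (f₀ * Phi hp v))) (hv0 : 0 ≤ v) (hne : v ≠ 0)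
    (hw : w = S N hp (mu • (f₀ * Phi hp w))) (hmu : 0 < mu) (hle : mu ≤ lam) :
    w ≤ 0 ∨ ∃ c : ℝ, 0 < c ∧ w = c • v := by
  by_cases hex : ∃ c : ℝ, 0 < c ∧ w = c • v
  · exact Or.inr hex
  left
  have hlam := hmu.trans_le hle
  have key : ∀ M : ℝ, 0 < M → w ≤ M • v := fun M hM => by
    have hMv := eigen_smul hv M
    have hM0 : 0 ≤ M • v := smul_nonneg hM.le hv0
    rw [hw, hMv]
    refine S_le_S_of_forall_smul N hp (smul_nonneg hlam.le (mul_Phi_nonneg hp hf₀ hM0))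
      (smul_ne_zero hlam.ne' (mul_Phi_ne_zero hp hf₀ (smul_ne_zero hM.ne' hne))) fun k hk hle' => ?_
    rw [← hw, ← hMv] at hle'
    rw [smul_comm, ← mul_Phi_smul]
    have h1 : mu • (f₀ * Phi hp (k • w)) ≤ mu • (f₀ * Phi hp (M • v)) :=
      smul_le_smul_of_nonneg_left (mul_Phi_mono hp hf₀ hle') hmu.le
    have h2 : mu • (f₀ * Phi hp (M • v)) ≤ lam • (f₀ * Phi hp (M • v)) :=
      smul_le_smul_of_nonneg_right hle (mul_Phi_nonneg hp hf₀ hM0)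
    refine ⟨h1.trans h2, fun heq => hex ⟨k⁻¹ * M, mul_pos (inv_pos.mpr hk.1) hM, ?_⟩⟩
    have h3 : mu • (f₀ * Phi hp (k • w)) = mu • (f₀ * Phi hp (M • v)) :=
      le_antisymm h1 (heq ▸ h2)
    have h4 : k • w = M • v :=
      mul_Phi_injective hp hf₀ (smul_right_injective Y hmu.ne' h3)
    rw [mul_smul, ← h4, inv_smul_smul₀ hk.1.ne']
  have hlim : Tendsto (fun M : ℝ => M • v) (𝓝[>] 0) (𝓝 0) := by
    have : Continuous fun M : ℝ => M • v := by fun_prop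
    have := this.tendsto 0
    rw [zero_smul] at this
    exact this.mono_left nhdsWithin_le_nhds
  refine ge_of_tendsto hlim ?_
  filter_upwards [self_mem_nhdsWithin] with M hM using key M hM

/-- The principal eigenvalue is simple. -/
theorem eigen_eq_smul {f₀ v w : Y} (hf₀ : ∀ r, 0 < f₀ r) {lam : ℝ}
    (hv : v = S N hp (lam • (f₀ * Phi hp v))) (hv0 : 0 ≤ v) (hne : v ≠ 0)
    (hw : w = S N hp (lam • (f₀ * Phi hp w))) : ∃ c : ℝ, w = c • v := by
  have hlam := pos_of_eigen hf₀ hv hv0 hne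
  -- Both w and -w are eigenfunctions: one of them is a positive multiple of v, or both are
  -- non-positive and w = 0.
  have hw' := eigen_smul hw (-1)
  rcases eigen_nonpos_or_eq_smul hf₀ hv hv0 hne hw hlam le_rfl with h | ⟨c, -, h⟩
  · rcases eigen_nonpos_or_eq_smul hf₀ hv hv0 hne hw' hlam le_rfl with h' | ⟨c, -, h'⟩
    · rw [neg_one_smul, neg_nonpos] at h'
      exact ⟨0, by rw [zero_smul]; exact le_antisymm h h'⟩
    · exact ⟨-c, by rw [neg_smul, ← h', neg_one_smul, neg_neg]⟩
  · exact ⟨c, h⟩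

/-- Non-negative eigenfunctions are multiples of each other, and have the same eigenvalue. -/
theorem eigen_unique {f₀ v w : Y} (hf₀ : ∀ r, 0 < f₀ r) {lam mu : ℝ}
    (hv : v = S N hp (lam • (f₀ * Phi hp v))) (hv0 : 0 ≤ v) (hvne : v ≠ 0)
    (hw : w = S N hp (mu • (f₀ * Phi hp w))) (hw0 : 0 ≤ w) (hwne : w ≠ 0) :
    mu = lam ∧ ∃ c : ℝ, 0 < c ∧ w = c • v := by
  have main : ∀ {v w : Y} {lam mu : ℝ}, v = S N hp (lam • (f₀ * Phi hp v)) → 0 ≤ v → v ≠ 0 →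
      w = S N hp (mu • (f₀ * Phi hp w)) → 0 ≤ w → w ≠ 0 → mu ≤ lam →
      mu = lam ∧ ∃ c : ℝ, 0 < c ∧ w = c • v := fun {v w lam mu} hv hv0 hvne hw hw0 hwne hle => by
    rcases eigen_nonpos_or_eq_smul hf₀ hv hv0 hvne hw (pos_of_eigen hf₀ hw hw0 hwne) hle with
      h | ⟨c, hc, h⟩
    · exact absurd (le_antisymm h hw0) hwne
    · refine ⟨?_, c, hc, h⟩
      have h1 : w = S N hp (lam • (f₀ * Phi hp w)) := by
        rw [h]
        exact eigen_smul hv c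
      rw [S_smul] at h1 hw
      have h2 : S N hp (f₀ * Phi hp w) ≠ 0 := fun h0 => hwne (by rw [hw, h0, smul_zero])
      exact phi_injective (one_lt_conj hp) (smul_left_injective ℝ h2 (hw.symm.trans h1))
  rcases le_total mu lam with h | h
  · exact main hv hv0 hvne hw hw0 hwne h
  · obtain ⟨h1, c, hc, h2⟩ := main hw hw0 hwne hv hv0 hvne h
    exact ⟨h1.symm, c⁻¹, inv_pos.mpr hc, by rw [h2, inv_smul_smul₀ hc.ne']⟩

variable (N hp)

/-- Functions in the range of `S_p` are dominated by every positive `S_p(h)`. -/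
theorem exists_smul_le_of_le {c : ℝ} (hc : 0 < c) (h : Y) :
    ∃ d > 0, ∀ r : unitInterval, d * S N hp h r ≤ c * (1 - r) := by
  have hC : 0 < phi (conj p) ‖h‖ + 1 := by
    have := phi_nonneg (q := conj p) (norm_nonneg h)
    linarith
  refine ⟨c / (phi (conj p) ‖h‖ + 1), div_pos hc hC, fun r => ?_⟩
  have hr : 0 ≤ 1 - (r : ℝ) := by linarith [r.2.2]
  have h1 : S N hp h r ≤ (phi (conj p) ‖h‖ + 1) * (1 - r) :=
    (le_abs_self _).trans ((abs_S_apply_le N hp h r).trans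
      (mul_le_mul_of_nonneg_right (by linarith) hr))
  calc c / (phi (conj p) ‖h‖ + 1) * S N hp h r
      ≤ c / (phi (conj p) ‖h‖ + 1) * ((phi (conj p) ‖h‖ + 1) * (1 - r)) :=
        mul_le_mul_of_nonneg_left h1 (div_pos hc hC).le
    _ = c * (1 - r) := by field_simp

/-- Existence of a non-negative eigenfunction: the greatest `t` with `t w ≤ S_p(f₀ φ_p(w))` for some
`w ≥ 0`, `w ≠ 0` is attained, at an eigenfunction. -/
theorem exists_eigen {f₀ : Y} (hf₀ : ∀ r, 0 < f₀ r) :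
    ∃ (lam : ℝ) (v : Y), v = S N hp (lam • (f₀ * Phi hp v)) ∧ 0 ≤ v ∧ v ≠ 0 := by
  set T : Y → Y := fun w => S N hp (f₀ * Phi hp w) with hT
  have hTc : Continuous T :=
    (continuous_S N hp).comp (continuous_const.mul (continuous_Phi hp))
  have hTm : Monotone T := (S_mono N hp).comp (mul_Phi_mono hp hf₀)
  have hTs : ∀ (c : ℝ) w, T (c • w) = c • T w := fun c w => by
    simp only [hT, mul_Phi_smul, S_phi_smul]
  have hT0 : ∀ {w}, 0 ≤ w → 0 ≤ T w := fun hw => S_nonneg N hp (mul_Phi_nonneg hp hf₀ hw)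
  set R := ‖f₀‖ * 1
  set K := closure (S N hp '' Metric.closedBall 0 R) with hKdef
  have hK : IsCompact K := isCompact_closure_S_image N hp R
  have hTK : ∀ w, ‖w‖ ≤ 1 → T w ∈ K := fun w hw => by
    refine subset_closure ⟨_, ?_, rfl⟩
    rw [mem_closedBall_zero_iff]
    refine (norm_mul_le _ _).trans (mul_le_mul_of_nonneg_left ?_ (norm_nonneg _))
    rw [ContinuousMap.norm_le _ zero_le_one]
    intro r
    rw [Phi_apply, Real.norm_eq_abs, abs_phi, ← phi_one p]
    exact phi_mono hp ((w.norm_coe_le_norm r).trans hw)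
  obtain ⟨B, hB⟩ := hK.isBounded.exists_norm_le
  -- The condition t ≤ ‖w‖ keeps a maximizer with t > 0 away from w = 0 and is closed, unlike w ≠ 0.
  set E : Set (ℝ × Y) := {x | x.1 ∈ Icc 0 B ∧ x.2 ∈ K} ∩
    {x | 0 ≤ x.2 ∧ x.1 • x.2 ≤ T x.2 ∧ x.1 ≤ ‖x.2‖}
  have hE : IsCompact E := by
    refine (isCompact_Icc.prod hK).inter_right ?_
    refine (isClosed_le continuous_const continuous_snd).inter
      ((isClosed_le (by fun_prop) (hTc.comp continuous_snd)).inter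
        (isClosed_le continuous_fst (by fun_prop)))
  -- Normalize w and apply T once: the pair (t, T u) satisfies the same inequality, lies in the
  -- compact set, and has t ≤ ‖T u‖.
  have hmem : ∀ {t : ℝ} {w : Y}, 0 < t → 0 ≤ w → w ≠ 0 → t • w ≤ T w →
      ∃ x ∈ E, x.1 = t := fun {t w} htpos hw hwne hle => by
    have ht := htpos.le
    have hn : 0 < ‖w‖ := norm_pos_iff.mpr hwne
    set u := ‖w‖⁻¹ • w with hu
    have hu1 : ‖u‖ = 1 := by
      rw [hu, norm_smul, norm_inv, norm_norm, inv_mul_cancel₀ hn.ne']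
    have hu0 : 0 ≤ u := smul_nonneg (inv_nonneg.mpr hn.le) hw
    have hule : t • u ≤ T u := by
      rw [hu, hTs, smul_comm]
      exact smul_le_smul_of_nonneg_left hle (inv_nonneg.mpr hn.le)
    have htn : t ≤ ‖T u‖ := by
      have h1 : ‖t • u‖ ≤ ‖T u‖ := by
        rw [ContinuousMap.norm_le _ (norm_nonneg _)]
        intro r
        have h2 : 0 ≤ (t • u) r := mul_nonneg ht (hu0 r)
        rw [Real.norm_of_nonneg h2]
        exact (hule r).trans ((le_abs_self _).trans ((T u).norm_coe_le_norm r))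
      rwa [norm_smul, hu1, mul_one, Real.norm_of_nonneg ht] at h1
    refine ⟨(t, T u), ⟨⟨⟨ht, htn.trans (hB _ (hTK u hu1.le))⟩, hTK u hu1.le⟩, hT0 hu0, ?_, htn⟩, rfl⟩
    change t • T u ≤ T (T u)
    rw [← hTs]
    exact hTm hule
  -- The constant 1 need not satisfy such an inequality at r = 1, but T 1 does, since T 1 and T(T 1)
  -- are both comparable with 1 - r.
  obtain ⟨t₁, ht₁, w₁, hw₁, hw₁ne, hle₁⟩ : ∃ t : ℝ, 0 < t ∧ ∃ w : Y, 0 ≤ w ∧ w ≠ 0 ∧ t • w ≤ T w := by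
    have h1 : (0 : Y) ≤ 1 := fun _ => zero_le_one
    have h2 : T 1 ≠ 0 := S_ne_zero N hp (mul_Phi_nonneg hp hf₀ h1)
      (mul_Phi_ne_zero hp hf₀ one_ne_zero)
    obtain ⟨c, hc, hcl⟩ := exists_le_S N hp (mul_Phi_nonneg hp hf₀ (hT0 h1))
      (mul_Phi_ne_zero hp hf₀ h2)
    obtain ⟨d, hd, hdl⟩ := exists_smul_le_of_le N hp hc (f₀ * Phi hp 1)
    exact ⟨d, hd, T 1, hT0 h1, h2, fun r => (hdl r).trans (hcl r)⟩
  obtain ⟨x₁, hx₁, hx₁'⟩ := hmem ht₁ hw₁ hw₁ne hle₁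
  obtain ⟨x, hx, hmax⟩ := hE.exists_isMaxOn ⟨x₁, hx₁⟩ continuous_fst.continuousOn
  obtain ⟨t, w⟩ := x
  have hub : ∀ {t' : ℝ} {w' : Y}, 0 < t' → 0 ≤ w' → w' ≠ 0 → t' • w' ≤ T w' → t' ≤ t :=
    fun {t' w'} ht' hw' hne' hle' => by
      obtain ⟨y, hy, rfl⟩ := hmem ht' hw' hne' hle'
      exact hmax hy
  have ht : 0 < t := ht₁.trans_le (hub ht₁ hw₁ hw₁ne hle₁)
  obtain ⟨⟨-, -⟩, hw0, hle, htn⟩ := hx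
  simp only at hw0 hle htn
  have hwne : w ≠ 0 := by
    rintro rfl
    rw [norm_zero] at htn
    linarith
  have hTw0 := hT0 hw0
  have hTwne : T w ≠ 0 := S_ne_zero N hp (mul_Phi_nonneg hp hf₀ hw0) (mul_Phi_ne_zero hp hf₀ hwne)
  have heq : t • w = T w := by
    by_contra hcon
    obtain ⟨c, hc, hcl⟩ := exists_le_S_sub N hp (mul_Phi_mono hp hf₀ hle)
      (fun h => hcon (mul_Phi_injective hp hf₀ h))
    obtain ⟨d, hd, hdl⟩ := exists_smul_le_of_le N hp hc (f₀ * Phi hp w)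
    have h1 : (t + d) • T w ≤ T (T w) := fun r => by
      have h2 := hcl r
      have h3 := hdl r
      have h4 : T (t • w) r = t * T w r := by rw [hTs]; rfl
      change S N hp (f₀ * Phi hp (t • w)) r = _ at h4
      change (t + d) * T w r ≤ T (T w) r
      change d * T w r ≤ _ at h3
      change _ ≤ T (T w) r - S N hp (f₀ * Phi hp (t • w)) r at h2
      rw [h4] at h2
      linarith
    linarith [hub (by linarith) hTw0 hTwne h1]
  refine ⟨phi p t⁻¹, w, ?_, hw0, hwne⟩
  rw [S_phi_smul]
  change w = t⁻¹ • T w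
  rw [← heq, inv_smul_smul₀ ht.ne']

variable {N}

theorem eigen_pos {f₀ v : Y} (hf₀ : ∀ r, 0 < f₀ r) {lam : ℝ}
    (hv : v = S N hp (lam • (f₀ * Phi hp v))) (hv0 : 0 ≤ v) (hne : v ≠ 0)
    (r : unitInterval) (hr : (r : ℝ) < 1) : 0 < v r := by
  have hlam := pos_of_eigen hf₀ hv hv0 hne
  obtain ⟨c, hc, H⟩ := exists_le_S N hp (smul_nonneg hlam.le (mul_Phi_nonneg hp hf₀ hv0))
    (smul_ne_zero hlam.ne' (mul_Phi_ne_zero hp hf₀ hne))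
  rw [← hv] at H
  exact (mul_pos hc (by linarith)).trans_le (H r)

theorem IsPrincipal.eigen {f₀ v : Y} {lam : ℝ} (h : IsPrincipal N p f₀ lam v) :
    v = S N hp (lam • (f₀ * Phi hp v)) := ((isPrincipal_iff hp).mp h).1

theorem IsPrincipal.nonneg {f₀ v : Y} {lam : ℝ} (h : IsPrincipal N p f₀ lam v) : 0 ≤ v := fun r => by
  change 0 ≤ v r
  rcases r.2.2.lt_or_eq with hr | hr
  · exact (h.pos r hr).le
  · rw [show r = 1 from Subtype.ext hr, h.mem.2.2.2]

theorem IsPrincipal.ne_zero {f₀ v : Y} {lam : ℝ} (h : IsPrincipal N p f₀ lam v) : v ≠ 0 := by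
  rintro rfl
  exact lt_irrefl _ (h.pos 0 zero_lt_one)

theorem IsPrincipal.sigma_self {f₀ v : Y} {lam : ℝ} (h : IsPrincipal N p f₀ lam v) :
    sigma N hp f₀ v v = 1 := (RadialPLaplacian.sigma_self N hp f₀ v).trans h.normalized

theorem sigma_smul_self (f₀ v : Y) {c : ℝ} (hc : 0 ≤ c) :
    sigma N hp f₀ (c • v) (c • v) = c ^ p * sigma N hp f₀ v v := by
  have h1 : sigma N hp f₀ (c • v) v = phi p c * sigma N hp f₀ v v := by
    unfold sigma
    rw [mul_Phi_smul, smul_mul_assoc, J_smul]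
  rw [sigma_smul, h1, ← mul_assoc, mul_comm c, phi_mul_self hp, abs_of_nonneg hc]

/-- Existence and uniqueness of the normalized principal eigenpair. -/
theorem existsUnique_isPrincipal (hp : 1 < p) {f₀ : Y} (hf₀ : ∀ r, 0 < f₀ r) :
    ∃! x : ℝ × Y, IsPrincipal N p f₀ x.1 x.2 := by
  obtain ⟨lam, v, hv, hv0, hne⟩ := exists_eigen N hp hf₀
  have hpos := eigen_pos hp hf₀ hv hv0 hne
  have hv1 : v 1 = 0 := by rw [hv]; exact S_apply_one N hp _
  have hs := sigma_pos N hp hf₀ hpos hv0 hne hv1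
  have hp0 : p ≠ 0 := by linarith
  -- The normalizing integral is homogeneous of degree p in v (`sigma_smul_self`).
  set c := (sigma N hp f₀ v v) ^ (-p⁻¹) with hcdef
  have hc : 0 < c := Real.rpow_pos_of_pos hs _
  have hP : IsPrincipal N p f₀ lam (c • v) := by
    refine (isPrincipal_iff hp).mpr ⟨eigen_smul hv c, fun r hr => mul_pos hc (hpos r hr), ?_⟩
    rw [← RadialPLaplacian.sigma_self N hp, sigma_smul_self hp f₀ v hc.le, hcdef,
      ← Real.rpow_mul hs.le, neg_mul, inv_mul_cancel₀ hp0, Real.rpow_neg_one,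
      inv_mul_cancel₀ hs.ne']
  refine ⟨(lam, c • v), hP, ?_⟩
  rintro ⟨mu, w⟩ hw
  simp only at hw
  obtain ⟨h1, d, hd, h2⟩ := eigen_unique hf₀ (hP.eigen hp) hP.nonneg hP.ne_zero (hw.eigen hp)
    hw.nonneg hw.ne_zero
  have h3 := hw.sigma_self hp
  rw [h2, sigma_smul_self hp _ _ hd.le, hP.sigma_self hp, mul_one] at h3
  have h4 : d = 1 := by
    rwa [← Real.one_rpow p, Real.rpow_left_inj hd.le zero_le_one hp0] at h3
  rw [h1, h2, h4, one_smul]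

end operator

/-! ### The quotient `f / φ_p` -/

/-- A positive continuous kernel `q` such that, for `ξ ≥ 0`, `q(r,ξ)` is non-increasing, strictly so
near `(1,0)`, while `q(r,ξ) φ_p(ξ)` is non-decreasing for `ξ ≤ ρ`. -/
structure OneSided (p : ℝ) (q : C(unitInterval × ℝ, ℝ)) (ρ : ℝ) : Prop where
  rho_pos : 0 < ρ
  pos : ∀ r ξ, 0 < q (r, ξ)
  anti : ∀ r, AntitoneOn (fun ξ => q (r, ξ)) (Ici 0)
  strict : ∃ δ > 0, ∀ r : unitInterval, 1 - δ < (r : ℝ) →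
    StrictAntiOn (fun ξ => q (r, ξ)) (Icc 0 ρ)
  mono : ∀ r, MonotoneOn (fun ξ => q (r, ξ) * phi p ξ) (Icc 0 ρ)

/-- The kernel `q(r,-ξ)`. -/
def reflect (q : C(unitInterval × ℝ, ℝ)) : C(unitInterval × ℝ, ℝ) :=
  ⟨fun x => q (x.1, -x.2), by fun_prop⟩

theorem reflect_apply (q : C(unitInterval × ℝ, ℝ)) (r : unitInterval) (ξ : ℝ) :
    reflect q (r, ξ) = q (r, -ξ) := rfl

/-- Isolates, up to a positive factor, the quantity g'ξ - (p-1)g whose sign is prescribed in (H').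
-/
theorem hasDerivAt_div_rpow {g : ℝ → ℝ} {g' ξ p : ℝ} (hξ : 0 < ξ) (hg : HasDerivAt g g' ξ) :
    HasDerivAt (fun x => g x / x ^ (p - 1))
      ((g' * ξ - (p - 1) * g ξ) * (ξ ^ (p - 2) / (ξ ^ (p - 1)) ^ 2)) ξ := by
  have h1 : ξ ^ (p - 1) = ξ ^ (p - 2) * ξ := by
    rw [← Real.rpow_add_one hξ.ne']
    congr 1
    ring
  have h2 := hg.div (Real.hasDerivAt_rpow_const (p := p - 1) (Or.inl hξ.ne'))
    (Real.rpow_pos_of_pos hξ _).ne'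
  refine h2.congr_deriv ?_
  rw [show p - 1 - 1 = p - 2 by ring, h1]
  ring

section kernel

variable {p : ℝ} {q : C(unitInterval × ℝ, ℝ)} {r : unitInterval} {g g' : ℝ → ℝ}

theorem hasDerivAt_kernel (hp : 1 < p) (hq : ∀ ξ, 0 ≤ ξ → q (r, ξ) * phi p ξ = g ξ)
    (hg : ∀ ξ, HasDerivAt g (g' ξ) ξ) {ξ : ℝ} (hξ : 0 < ξ) : HasDerivAt (fun x => q (r, x))
      ((g' ξ * ξ - (p - 1) * g ξ) * (ξ ^ (p - 2) / (ξ ^ (p - 1)) ^ 2)) ξ := by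
  refine (hasDerivAt_div_rpow (p := p) hξ (hg ξ)).congr_of_eventuallyEq ?_
  filter_upwards [lt_mem_nhds hξ] with x hx
  rw [← hq x hx.le, phi_of_nonneg hp hx.le, mul_div_cancel_right₀]
  exact (Real.rpow_pos_of_pos hx _).ne'

theorem antitoneOn_kernel (hp : 1 < p) (hq : ∀ ξ, 0 ≤ ξ → q (r, ξ) * phi p ξ = g ξ)
    (hg : ∀ ξ, HasDerivAt g (g' ξ) ξ) (hle : ∀ ξ, 0 < ξ → g' ξ * ξ ≤ (p - 1) * g ξ) :
    AntitoneOn (fun ξ => q (r, ξ)) (Ici 0) := by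
  have hcont : Continuous fun x => q (r, x) := by fun_prop
  refine antitoneOn_of_deriv_nonpos (convex_Ici 0) hcont.continuousOn ?_ ?_
  · rw [interior_Ici]
    exact fun ξ hξ => (hasDerivAt_kernel hp hq hg hξ).differentiableAt.differentiableWithinAt
  · rw [interior_Ici]
    intro ξ hξ
    have hξ' : 0 < ξ := hξ
    rw [(hasDerivAt_kernel hp hq hg hξ').deriv]
    exact mul_nonpos_of_nonpos_of_nonneg (sub_nonpos.mpr (hle ξ hξ')) (by positivity)

theorem strictAntiOn_kernel (hp : 1 < p) (hq : ∀ ξ, 0 ≤ ξ → q (r, ξ) * phi p ξ = g ξ)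
    (hg : ∀ ξ, HasDerivAt g (g' ξ) ξ) {ρ : ℝ}
    (hlt : ∀ ξ ∈ Ioo 0 ρ, g' ξ * ξ < (p - 1) * g ξ) :
    StrictAntiOn (fun ξ => q (r, ξ)) (Icc 0 ρ) := by
  have hcont : Continuous fun x => q (r, x) := by fun_prop
  refine strictAntiOn_of_deriv_neg (convex_Icc 0 ρ) hcont.continuousOn ?_
  rw [interior_Icc]
  intro ξ hξ
  have hξ' : 0 < ξ := hξ.1
  rw [(hasDerivAt_kernel hp hq hg hξ').deriv]
  exact mul_neg_of_neg_of_pos (sub_neg.mpr (hlt ξ hξ)) (by positivity)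

end kernel

theorem oneSided_of_hasDerivAt {p : ℝ} (hp : 1 < p) {q : C(unitInterval × ℝ, ℝ)}
    {g g' : unitInterval → ℝ → ℝ} {ρ : ℝ} (hρ : 0 < ρ) (hpos : ∀ r ξ, 0 < q (r, ξ))
    (hq : ∀ r ξ, 0 ≤ ξ → q (r, ξ) * phi p ξ = g r ξ)
    (hg : ∀ r ξ, HasDerivAt (g r) (g' r ξ) ξ)
    (hle : ∀ r ξ, 0 < ξ → g' r ξ * ξ ≤ (p - 1) * g r ξ)
    (hlt : ∃ δ > 0, ∀ r : unitInterval, 1 - δ < (r : ℝ) →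
      ∀ ξ ∈ Ioo 0 ρ, g' r ξ * ξ < (p - 1) * g r ξ)
    (hg' : ∀ r, ∀ ξ ∈ Ioo 0 ρ, 0 ≤ g' r ξ) : OneSided p q ρ := by
  obtain ⟨δ, hδ, hlt⟩ := hlt
  refine ⟨hρ, hpos, fun r => antitoneOn_kernel hp (hq r) (hg r) (hle r),
    ⟨δ, hδ, fun r hr => strictAntiOn_kernel hp (hq r) (hg r) (hlt r hr)⟩, fun r => ?_⟩
  · have h1 : MonotoneOn (g r) (Icc 0 ρ) := by
      refine monotoneOn_of_deriv_nonneg (convex_Icc 0 ρ)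
        (fun ξ _ => (hg r ξ).continuousAt.continuousWithinAt)
        (fun ξ _ => (hg r ξ).differentiableAt.differentiableWithinAt) ?_
      rw [interior_Icc]
      intro ξ hξ
      rw [(hg r ξ).deriv]
      exact hg' r ξ hξ
    exact h1.congr fun ξ hξ => (hq r ξ hξ.1).symm

namespace Hyp

variable {N : ℕ} {p : ℝ} {f : C(unitInterval × ℝ, ℝ)} {f₀ finf : Y}

/-- Joint continuity at ξ = 0 comes from the uniformity in r of the limit, combined with the
continuity of f₀. -/
theorem continuous_quot (hf : Hyp N p f f₀ finf) (hp : 1 < p) :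
    Continuous fun x : unitInterval × ℝ => if x.2 = 0 then f₀ x.1 else f x / phi p x.2 := by
  rw [continuous_iff_continuousAt]
  rintro ⟨r, ξ⟩
  rcases eq_or_ne ξ 0 with rfl | hξ
  · rw [ContinuousAt, if_pos rfl]
    refine Metric.tendsto_nhds.mpr fun ε hε => ?_
    have h1 := Metric.tendstoUniformly_iff.mp hf.lim_zero (ε / 2) (half_pos hε)
    rw [eventually_nhdsWithin_iff] at h1
    have h2 : ∀ᶠ r' in 𝓝 r, dist (f₀ r') (f₀ r) < ε / 2 :=
      Metric.tendsto_nhds.mp (f₀.continuous.tendsto r) _ (half_pos hε)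
    filter_upwards [prod_mem_nhds h2 h1] with x hx
    obtain ⟨hx1, hx2⟩ := hx
    simp only [mem_ofPred_eq] at hx1 hx2
    split_ifs with h
    · linarith
    · have h3 := hx2 h x.1
      rw [dist_comm] at h3
      exact (dist_triangle _ _ _).trans_lt ((add_lt_add h3 hx1).trans_eq (add_halves ε))
  · have h1 : ContinuousAt (fun x : unitInterval × ℝ => f x / phi p x.2) (r, ξ) :=
      f.continuous.continuousAt.div ((continuous_phi hp).comp continuous_snd).continuousAt
        (phi_ne_zero hξ)
    refine h1.congr ?_
    filter_upwards [continuous_snd.continuousAt.eventually_ne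
      (show (r, ξ).2 ≠ 0 from hξ)] with x hx
    rw [if_neg hx]

/-- The continuous extension of `f(r,ξ) / φ_p(ξ)` by `f₀(r)` at `ξ = 0`. -/
def quot (hf : Hyp N p f f₀ finf) (hp : 1 < p) : C(unitInterval × ℝ, ℝ) :=
  ⟨_, hf.continuous_quot hp⟩

theorem quot_zero (hf : Hyp N p f f₀ finf) (hp : 1 < p) (r : unitInterval) :
    hf.quot hp (r, 0) = f₀ r := if_pos rfl

theorem quot_mul_phi (hf : Hyp N p f f₀ finf) (hp : 1 < p) (r : unitInterval) (ξ : ℝ) :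
    hf.quot hp (r, ξ) * phi p ξ = f (r, ξ) := by
  rcases eq_or_ne ξ 0 with rfl | hξ
  · rw [phi_zero, mul_zero, hf.zero]
  · rw [quot, ContinuousMap.coe_mk, if_neg hξ, div_mul_cancel₀ _ (phi_ne_zero hξ)]

theorem hasDerivAt (hf : Hyp N p f f₀ finf) (r : unitInterval) (ξ : ℝ) :
    HasDerivAt (fun η => f (r, η)) (d2 f r ξ) ξ :=
  ((hf.contDiff r).differentiable one_ne_zero ξ).hasDerivAt

theorem quot_pos_of_ne (hf : Hyp N p f f₀ finf) (hp : 1 < p) (r : unitInterval) {ξ : ℝ}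
    (hξ : ξ ≠ 0) : 0 < hf.quot hp (r, ξ) := by
  have h1 := hf.sign r ξ hξ
  rw [← hf.quot_mul_phi hp, mul_assoc, phi_mul_self hp] at h1
  exact pos_of_mul_pos_left h1 (by positivity)

/-- The quotient is non-increasing on ξ ≥ 0, so its value f₀(r) at 0 is at least its value at 1,
which is positive by the sign condition. -/
theorem f₀_pos (hf : Hyp N p f f₀ finf) (hp : 1 < p) (r : unitInterval) : 0 < f₀ r := by
  have h1 := antitoneOn_kernel hp (fun ξ _ => hf.quot_mul_phi hp r ξ) (hf.hasDerivAt r)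
    fun ξ hξ => hf.mono_pos r ξ hξ.le
  have h2 := h1 (mem_Ici.mpr le_rfl) (mem_Ici.mpr zero_le_one) zero_le_one
  simp only [quot_zero] at h2
  exact (hf.quot_pos_of_ne hp r one_ne_zero).trans_le h2

theorem quot_pos (hf : Hyp N p f f₀ finf) (hp : 1 < p) (r : unitInterval) (ξ : ℝ) :
    0 < hf.quot hp (r, ξ) := by
  rcases eq_or_ne ξ 0 with rfl | hξ
  · rw [quot_zero]
    exact hf.f₀_pos hp r
  · exact hf.quot_pos_of_ne hp r hξ

/-- ∂₂f/|ξ|^(p-2) tends uniformly to (p-1)f₀, which has a positive minimum on [0,1]. -/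
theorem exists_d2_pos (hf : Hyp N p f f₀ finf) (hp : 1 < p) :
    ∃ ρ > 0, ∀ r ξ, ξ ≠ 0 → |ξ| < ρ → 0 < d2 f r ξ := by
  obtain ⟨r₀, -, hr₀⟩ := isCompact_univ.exists_isMinOn univ_nonempty f₀.continuous.continuousOn
  have hm : 0 < (p - 1) * f₀ r₀ := mul_pos (by linarith) (hf.f₀_pos hp r₀)
  have h1 := Metric.tendstoUniformly_iff.mp hf.lim_zero_d2 _ hm
  rw [eventually_nhdsWithin_iff, Metric.eventually_nhds_iff] at h1
  obtain ⟨ρ, hρ, H⟩ := h1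
  refine ⟨ρ, hρ, fun r ξ hξ hlt => ?_⟩
  have h2 := H (y := ξ) (by rwa [Real.dist_eq, sub_zero]) hξ r
  rw [Real.dist_eq] at h2
  have h3 := (abs_lt.mp h2).2
  have h4 : (p - 1) * f₀ r₀ ≤ (p - 1) * f₀ r :=
    mul_le_mul_of_nonneg_left (hr₀ (mem_univ r)) (sub_nonneg.mpr hp.le)
  have h5 : 0 < d2 f r ξ / |ξ| ^ (p - 2) := (sub_lt_self_iff _).mp (h3.trans_le h4)
  exact (div_pos_iff_of_pos_right (Real.rpow_pos_of_pos (abs_pos.mpr hξ) _)).mp h5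

theorem exists_oneSided (hf : Hyp N p f f₀ finf) (hp : 1 < p) :
    ∃ ρ, OneSided p (hf.quot hp) ρ ∧ OneSided p (reflect (hf.quot hp)) ρ := by
  obtain ⟨ρ₁, hρ₁, H₁⟩ := hf.exists_d2_pos hp
  obtain ⟨δ, hδ, ε, hε, H₂⟩ := hf.mono_strict
  have hlt : ∀ {ξ}, ξ ∈ Ioo 0 (min ρ₁ ε) → ξ < ρ₁ ∧ ξ < ε := fun hξ =>
    lt_min_iff.mp hξ.2
  refine ⟨min ρ₁ ε, ?_, ?_⟩
  · refine oneSided_of_hasDerivAt hp (lt_min hρ₁ hε) (hf.quot_pos hp)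
      (g := fun r ξ => f (r, ξ)) (g' := fun r ξ => d2 f r ξ) (fun r ξ _ => hf.quot_mul_phi hp r ξ)
      hf.hasDerivAt (fun r ξ hξ => hf.mono_pos r ξ hξ.le)
      ⟨δ, hδ, fun r hr ξ hξ => (H₂ r hr).1 ξ ⟨hξ.1, (hlt hξ).2⟩⟩ fun r ξ hξ => ?_
    exact (H₁ r ξ hξ.1.ne' (by rw [abs_of_pos hξ.1]; exact (hlt hξ).1)).le
  -- The reflected kernel belongs to g(ξ) = -f(r,-ξ), for which the conditions at negative arguments
  -- become those at positive ones.
  · refine oneSided_of_hasDerivAt hp (lt_min hρ₁ hε) (fun r ξ => hf.quot_pos hp r (-ξ))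
      (g := fun r ξ => -f (r, -ξ)) (g' := fun r ξ => d2 f r (-ξ)) (fun r ξ _ => ?_)
      (fun r ξ => ?_) (fun r ξ hξ => ?_) ⟨δ, hδ, fun r hr ξ hξ => ?_⟩ fun r ξ hξ => ?_
    · rw [reflect_apply, ← hf.quot_mul_phi hp, phi_neg, mul_neg, neg_neg]
    · exact ((hf.hasDerivAt r (-ξ)).comp ξ (hasDerivAt_neg ξ)).neg.congr_deriv (by ring)
    · linarith [hf.mono_neg r (-ξ) (by linarith)]
    · linarith [(H₂ r hr).2 (-ξ) ⟨by linarith [(hlt hξ).2], by linarith [hξ.1]⟩]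
    · refine (H₁ r (-ξ) (by linarith [hξ.1]) ?_).le
      rw [abs_neg, abs_of_pos hξ.1]
      exact (hlt hξ).1

end Hyp

/-! ### The rescaled problem -/

section operator

variable (N : ℕ) {p : ℝ} (hp : 1 < p)

/-- `H(s,w)(r) = q(r, s w(r)) φ_p(w(r))`. -/
def kernelOp (q : C(unitInterval × ℝ, ℝ)) (s : ℝ) (w : Y) : Y := nemytskii q (s • w) * Phi hp w

theorem kernelOp_apply (q : C(unitInterval × ℝ, ℝ)) (s : ℝ) (w : Y) (r : unitInterval) :
    kernelOp hp q s w r = q (r, s * w r) * phi p (w r) := rfl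

/-- `w` solves `w = S_p(λ q(s w) φ_p(w))`. -/
def Sol (q : C(unitInterval × ℝ, ℝ)) (s lam : ℝ) (w : Y) : Prop :=
  w = S N hp (lam • kernelOp hp q s w)

theorem continuous_kernelOp (q : C(unitInterval × ℝ, ℝ)) :
    Continuous fun x : ℝ × Y => kernelOp hp q x.1 x.2 :=
  ((continuous_nemytskii q).comp (continuous_fst.smul continuous_snd)).mul
    ((continuous_Phi hp).comp continuous_snd)

theorem continuous_smul_kernelOp (q : C(unitInterval × ℝ, ℝ)) :
    Continuous fun x : ℝ × ℝ × Y => x.2.1 • kernelOp hp q x.1 x.2.2 := by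
  refine (continuous_fst.comp continuous_snd).smul ?_
  exact (continuous_kernelOp hp q).comp (by fun_prop : Continuous fun x : ℝ × ℝ × Y => (x.1, x.2.2))

theorem isClosed_sol (q : C(unitInterval × ℝ, ℝ)) :
    IsClosed {x : ℝ × ℝ × Y | Sol N hp q x.1 x.2.1 x.2.2} :=
  isClosed_eq (continuous_snd.comp continuous_snd) ((continuous_S N hp).comp (continuous_smul_kernelOp hp q))

theorem kernelOp_smul (q : C(unitInterval × ℝ, ℝ)) (s c : ℝ) (w : Y) :
    kernelOp hp q s (c • w) = phi p c • kernelOp hp q (s * c) w := by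
  unfold kernelOp
  rw [Phi_smul, smul_smul, mul_smul_comm]

/-- Homogeneity moves an amplitude between w and s; this links the original problem (s = 1) to the
rescaled one. -/
theorem sol_smul_iff (q : C(unitInterval × ℝ, ℝ)) {s c lam : ℝ} (hc : c ≠ 0) (w : Y) :
    Sol N hp q s lam (c • w) ↔ Sol N hp q (s * c) lam w := by
  unfold Sol
  rw [kernelOp_smul, smul_comm lam, S_phi_smul]
  exact (smul_right_injective Y hc).eq_iff

theorem sol_reflect_iff (q : C(unitInterval × ℝ, ℝ)) (s lam : ℝ) (w : Y) :
    Sol N hp (reflect q) s lam w ↔ Sol N hp q (-s) lam w := by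
  have h : kernelOp hp (reflect q) s w = kernelOp hp q (-s) w := by
    ext r
    rw [kernelOp_apply, kernelOp_apply, reflect_apply, neg_mul]
  unfold Sol
  rw [h]

theorem kernelOp_zero_left {q : C(unitInterval × ℝ, ℝ)} {f₀ : Y} (hq : ∀ r, q (r, 0) = f₀ r)
    (w : Y) : kernelOp hp q 0 w = f₀ * Phi hp w := by
  ext r
  rw [kernelOp_apply, zero_mul, hq]
  rfl

theorem sol_zero_iff {q : C(unitInterval × ℝ, ℝ)} {f₀ : Y} (hq : ∀ r, q (r, 0) = f₀ r)
    (lam : ℝ) (w : Y) : Sol N hp q 0 lam w ↔ w = S N hp (lam • (f₀ * Phi hp w)) := by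
  unfold Sol
  rw [kernelOp_zero_left hp hq]

theorem sol_apply_one {q : C(unitInterval × ℝ, ℝ)} {s lam : ℝ} {w : Y} (h : Sol N hp q s lam w) :
    w 1 = 0 := by
  rw [h]
  exact S_apply_one N hp _

variable {N} {hp}

theorem Hyp.F_eq_zero_iff {f : C(unitInterval × ℝ, ℝ)} {f₀ finf : Y} (hf : Hyp N p f f₀ finf)
    (lam : ℝ) (u : Y) : F N hp f lam u = 0 ↔ Sol N hp (hf.quot hp) 1 lam u := by
  have h : nemytskii f u = kernelOp hp (hf.quot hp) 1 u := by
    ext r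
    rw [kernelOp_apply, one_mul, hf.quot_mul_phi hp, nemytskii_apply]
  rw [F, Sol, sub_eq_zero, S_smul, h]

theorem Hyp.G_eq_zero_iff {f : C(unitInterval × ℝ, ℝ)} {f₀ finf : Y} (hf : Hyp N p f f₀ finf)
    (v₀ : Y) (s lam : ℝ) (z : Z N hp f₀ v₀) :
    G N hp f f₀ v₀ s lam z = 0 ↔ Sol N hp (hf.quot hp) s lam (v₀ + z) := by
  unfold G
  split_ifs with hs
  · rw [hs, sol_zero_iff N hp (hf.quot_zero hp), sub_eq_zero]
  · have h : (lam / phi p s) • nemytskii f (s • (v₀ + z : Y)) =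
        lam • kernelOp hp (hf.quot hp) s (v₀ + z) := by
      ext r
      simp only [ContinuousMap.smul_apply, smul_eq_mul, kernelOp_apply, nemytskii_apply]
      rw [← hf.quot_mul_phi hp, phi_mul]
      have := phi_ne_zero (q := p) hs
      field_simp
    rw [h, sub_eq_zero, Sol]

end operator

/-- If `g(x,·)` has a unique zero in a compact set, then this zero depends continuously on `x`. -/
theorem continuousOn_of_unique_zero {X E : Type*} [TopologicalSpace X] [TopologicalSpace E]
    {P : Set (X × E)} (hP : IsClosed P) {K : Set E} (hK : IsCompact K) {A : Set X} {y : X → E}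
    (hy : ∀ x ∈ A, y x ∈ K ∧ (x, y x) ∈ P) (huniq : ∀ x ∈ A, ∀ e ∈ K, (x, e) ∈ P → e = y x) :
    ContinuousOn y A := by
  intro x hx
  rw [ContinuousWithinAt, tendsto_nhds]
  intro V hV hxV
  -- Over x no zero lies in the compact set K \ V; since P is closed, the same holds over nearby
  -- points, by a tube argument.
  have hbad : IsCompact (K \ V) := hK.diff hV
  have h1 : ∀ᶠ x' in 𝓝 x, ∀ e ∈ K \ V, (x', e) ∉ P := by
    refine hbad.eventually_forall_of_forall_eventually fun e he => ?_
    refine hP.isOpen_compl.mem_nhds fun h => he.2 ?_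
    rw [huniq x hx e he.1 h]
    exact hxV
  filter_upwards [mem_nhdsWithin_of_mem_nhds h1, self_mem_nhdsWithin] with x' hx' hxA
  by_contra h
  exact hx' (y x') ⟨(hy x' hxA).1, h⟩ (hy x' hxA).2

/-! ### Small solutions: order, uniqueness, existence by sub- and supersolutions -/

section operator

variable {N : ℕ} {p : ℝ} {hp : 1 < p} {q : C(unitInterval × ℝ, ℝ)} {ρ : ℝ}

namespace OneSided

theorem kernelOp_nonneg (hq : OneSided p q ρ) (s : ℝ) {w : Y} (hw : 0 ≤ w) :
    0 ≤ kernelOp hp q s w := fun r => mul_nonneg (hq.pos r _).le (phi_nonneg (hw r))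

theorem kernelOp_ne_zero (hq : OneSided p q ρ) (s : ℝ) {w : Y} (hw : w ≠ 0) :
    kernelOp hp q s w ≠ 0 := fun h => hw <| by
  ext r
  have h1 : q (r, s * w r) * phi p (w r) = 0 := congrArg (fun y : Y => y r) h
  by_contra h0
  exact mul_ne_zero (hq.pos r _).ne' (phi_ne_zero h0) h1

theorem sol_pos (hq : OneSided p q ρ) {s lam : ℝ} {w : Y} (h : Sol N hp q s lam w) (hlam : 0 < lam)
    (hw : 0 ≤ w) (hne : w ≠ 0) (r : unitInterval) (hr : (r : ℝ) < 1) : 0 < w r := by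
  obtain ⟨c, hc, H⟩ := exists_le_S N hp (smul_nonneg hlam.le (hq.kernelOp_nonneg (hp := hp) s hw))
    (smul_ne_zero hlam.ne' (hq.kernelOp_ne_zero s hne))
  rw [← h] at H
  exact (mul_pos hc (by linarith)).trans_le (H r)

theorem kernelOp_mono (hq : OneSided p q ρ) {u w : Y} (hu : 0 ≤ u) (huw : u ≤ w) (hw : ‖w‖ ≤ ρ) :
    kernelOp hp q 1 u ≤ kernelOp hp q 1 w := fun r => by
  change q (r, 1 * u r) * phi p (u r) ≤ q (r, 1 * w r) * phi p (w r)
  rw [one_mul, one_mul]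
  have h1 : w r ≤ ρ := (le_abs_self _).trans ((w.norm_coe_le_norm r).trans hw)
  exact hq.mono r ⟨hu r, (huw r).trans h1⟩ ⟨(hu r).trans (huw r), h1⟩ (huw r)

/-- There are points `r < 1` at which `q(r,·)` is strictly decreasing. -/
theorem exists_strict (hq : OneSided p q ρ) :
    ∃ r : unitInterval, (r : ℝ) < 1 ∧ StrictAntiOn (fun ξ => q (r, ξ)) (Icc 0 ρ) := by
  obtain ⟨δ, hδ, H⟩ := hq.strict
  obtain ⟨r, hr1, hr2⟩ := exists_between (max_lt (zero_lt_one' ℝ) (by linarith : 1 - δ < 1))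
  exact ⟨⟨r, (le_max_left _ _).trans hr1.le, hr2.le⟩, hr2, H _ ((le_max_right _ _).trans_lt hr1)⟩

/-- Shrinking u ≥ 0 can only raise q(r,u), so the kernel is sub-homogeneous relative to φ_p. -/
theorem phi_smul_kernelOp_le (hq : OneSided p q ρ) {k : ℝ} (hk : k ∈ Icc (0 : ℝ) 1) {u : Y}
    (hu : 0 ≤ u) : phi p k • kernelOp hp q 1 u ≤ kernelOp hp q 1 (k • u) := fun r => by
  change phi p k * (q (r, 1 * u r) * phi p (u r)) ≤ q (r, 1 * (k * u r)) * phi p (k * u r)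
  have h0 : 0 ≤ u r := hu r
  have h1 : q (r, u r) ≤ q (r, k * u r) :=
    hq.anti r (mul_nonneg hk.1 h0) h0 (mul_le_of_le_one_left h0 hk.2)
  rw [one_mul, one_mul, phi_mul]
  have h2 := mul_nonneg (phi_nonneg (q := p) hk.1) (phi_nonneg (q := p) h0)
  calc phi p k * (q (r, u r) * phi p (u r)) = q (r, u r) * (phi p k * phi p (u r)) := by ring
    _ ≤ _ := mul_le_mul_of_nonneg_right h1 h2

/-- Strict decrease of q at a single r < 1 suffices, because strong monotonicity needs only that the
two functions differ. -/
theorem phi_smul_kernelOp_ne (hq : OneSided p q ρ) {k : ℝ} (hk : k ∈ Ioo (0 : ℝ) 1) {u : Y}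
    (hpos : ∀ r : unitInterval, (r : ℝ) < 1 → 0 < u r) (hρ : ‖u‖ ≤ ρ) :
    phi p k • kernelOp hp q 1 u ≠ kernelOp hp q 1 (k • u) := fun h => by
  obtain ⟨r, hr, H⟩ := hq.exists_strict
  have h1 : phi p k * (q (r, 1 * u r) * phi p (u r)) = q (r, 1 * (k * u r)) * phi p (k * u r) :=
    congrArg (fun y : Y => y r) h
  rw [one_mul, one_mul, phi_mul] at h1
  have h0 := hpos r hr
  have h2 : u r ≤ ρ := (le_abs_self _).trans ((u.norm_coe_le_norm r).trans hρ)
  have h3 : k * u r < u r := mul_lt_of_lt_one_left h0 hk.2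
  have h4 : q (r, u r) < q (r, k * u r) :=
    H ⟨(mul_pos hk.1 h0).le, h3.le.trans h2⟩ ⟨h0.le, h2⟩ h3
  have h5 := mul_pos (phi_pos (q := p) hk.1) (phi_pos (q := p) h0)
  have h6 := mul_lt_mul_of_pos_right h4 h5
  linarith

/-- Small non-negative solutions increase with `λ`. -/
theorem sol_le_sol (hq : OneSided p q ρ) {lam₁ lam₂ : ℝ} {u₁ u₂ : Y}
    (h₁ : Sol N hp q 1 lam₁ u₁) (h₂ : Sol N hp q 1 lam₂ u₂) (hlam₁ : 0 < lam₁)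
    (hle : lam₁ ≤ lam₂) (hu₁ : 0 ≤ u₁) (hu₂ : 0 ≤ u₂) (hne₁ : u₁ ≠ 0) (hne₂ : u₂ ≠ 0)
    (hρ₁ : ‖u₁‖ ≤ ρ) (hρ₂ : ‖u₂‖ ≤ ρ) : u₁ ≤ u₂ := by
  have hlam₂ := hlam₁.trans_le hle
  have h0 := hq.kernelOp_nonneg (hp := hp) 1 hu₂
  rw [h₁, h₂]
  refine S_le_S_of_forall_smul N hp (smul_nonneg hlam₂.le h0)
    (smul_ne_zero hlam₂.ne' (hq.kernelOp_ne_zero 1 hne₂)) fun k hk hk' => ?_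
  rw [← h₁, ← h₂] at hk'
  have hk1 : k ∈ Icc (0 : ℝ) 1 := Ioo_subset_Icc_self hk
  rw [smul_comm]
  -- With H the kernel operator: φ_p(k)λ₁H(u₁) ≤ λ₁H(ku₁) ≤ λ₁H(u₂) ≤ λ₂H(u₂), and the first
  -- inequality is never an equality.
  have e1 := smul_le_smul_of_nonneg_left (hq.phi_smul_kernelOp_le (hp := hp) hk1 hu₁) hlam₁.le
  have e2 := smul_le_smul_of_nonneg_left
    (hq.kernelOp_mono (hp := hp) (smul_nonneg hk.1.le hu₁) hk' hρ₂) hlam₁.le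
  have e3 := smul_le_smul_of_nonneg_right hle h0
  refine ⟨e1.trans (e2.trans e3), fun heq => ?_⟩
  refine hq.phi_smul_kernelOp_ne (hp := hp) hk (hq.sol_pos h₁ hlam₁ hu₁ hne₁) hρ₁ ?_
  exact smul_right_injective Y hlam₁.ne' (le_antisymm e1 ((e2.trans e3).trans_eq heq.symm))

theorem eq_of_sol (hq : OneSided p q ρ) {s lam₁ lam₂ : ℝ} {u : Y}
    (h₁ : Sol N hp q s lam₁ u) (h₂ : Sol N hp q s lam₂ u) (hu : 0 ≤ u) (hne : u ≠ 0) :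
    lam₁ = lam₂ := by
  have h0 := S_ne_zero N hp (hq.kernelOp_nonneg (hp := hp) s hu) (hq.kernelOp_ne_zero s hne)
  unfold Sol at h₁ h₂
  rw [S_smul] at h₁ h₂
  exact phi_injective (one_lt_conj hp) (smul_left_injective ℝ h0 (h₁.symm.trans h₂))

/-- Small non-negative solutions are determined by the value of `σ`. -/
theorem sol_unique (hq : OneSided p q ρ) {f₀ v₀ : Y} (hf₀ : ∀ r, 0 < f₀ r)
    (hv₀ : ∀ r : unitInterval, (r : ℝ) < 1 → 0 < v₀ r) {lam₁ lam₂ : ℝ} {u₁ u₂ : Y}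
    (h₁ : Sol N hp q 1 lam₁ u₁) (h₂ : Sol N hp q 1 lam₂ u₂) (hlam₁ : 0 < lam₁)
    (hlam₂ : 0 < lam₂) (hu₁ : 0 ≤ u₁) (hu₂ : 0 ≤ u₂) (hne₁ : u₁ ≠ 0) (hne₂ : u₂ ≠ 0)
    (hρ₁ : ‖u₁‖ ≤ ρ) (hρ₂ : ‖u₂‖ ≤ ρ) (hσ : sigma N hp f₀ v₀ u₁ = sigma N hp f₀ v₀ u₂) :
    lam₁ = lam₂ ∧ u₁ = u₂ := by
  have main : ∀ {lam₁ lam₂ : ℝ} {u₁ u₂ : Y}, Sol N hp q 1 lam₁ u₁ → Sol N hp q 1 lam₂ u₂ →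
      u₁ ≤ u₂ → sigma N hp f₀ v₀ u₁ = sigma N hp f₀ v₀ u₂ → u₁ = u₂ :=
    fun {lam₁ lam₂ u₁ u₂} h₁ h₂ hle hσ => by
      by_contra hne
      have h3 := sigma_pos N hp hf₀ hv₀ (sub_nonneg.mpr hle) (sub_ne_zero.mpr (Ne.symm hne))
        (by rw [ContinuousMap.sub_apply, sol_apply_one N hp h₁, sol_apply_one N hp h₂, sub_zero])
      rw [sigma_sub, hσ, sub_self] at h3
      exact lt_irrefl _ h3
  have heq : u₁ = u₂ := by
    rcases le_total lam₁ lam₂ with hle | hle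
    · exact main h₁ h₂ (hq.sol_le_sol h₁ h₂ hlam₁ hle hu₁ hu₂ hne₁ hne₂ hρ₁ hρ₂) hσ
    · exact (main h₂ h₁ (hq.sol_le_sol h₂ h₁ hlam₂ hle hu₂ hu₁ hne₂ hne₁ hρ₂ hρ₁) hσ.symm).symm
  subst heq
  exact ⟨hq.eq_of_sol h₁ h₂ hu₁ hne₁, rfl⟩

end OneSided

/-- A continuous map that is increasing on an order interval between a sub- and a supersolution and
maps it to a relatively compact set has a fixed point there. -/
theorem exists_fixedPoint {T : Y → Y} (hT : Continuous T) {a b : Y} (hab : a ≤ b)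
    (hmono : ∀ u w, a ≤ u → u ≤ w → w ≤ b → T u ≤ T w) (ha : a ≤ T a) (hb : T b ≤ b)
    {K : Set Y} (hK : IsCompact K) (hTK : ∀ u, a ≤ u → u ≤ b → T u ∈ K) :
    ∃ u, a ≤ u ∧ u ≤ b ∧ T u = u := by
  have hstep : ∀ n, a ≤ T^[n] b ∧ T^[n + 1] b ≤ T^[n] b ∧ T^[n] b ≤ b := fun n => by
    induction n with
    | zero => exact ⟨hab, hb, le_rfl⟩
    | succ n ih =>
      obtain ⟨h1, h2, h3⟩ := ih
      rw [Function.iterate_succ_apply'] at h2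
      rw [Function.iterate_succ_apply', Function.iterate_succ_apply']
      have h4 : a ≤ T (T^[n] b) := ha.trans (hmono _ _ le_rfl h1 h3)
      exact ⟨h4, by rw [Function.iterate_succ_apply']; exact hmono _ _ h4 h2 h3, h2.trans h3⟩
  have hanti : Antitone fun n => T^[n] b := antitone_nat_of_succ_le fun n => (hstep n).2.1
  have hmem : ∀ n, T^[n + 1] b ∈ K := fun n => by
    rw [Function.iterate_succ_apply']
    exact hTK _ (hstep n).1 (hstep n).2.2
  -- The iterates decrease from the supersolution, so a subsequential limit lies below all of them;
  -- continuity then gives T u = u.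
  obtain ⟨u, -, φ, hφ, hlim⟩ := hK.tendsto_subseq hmem
  have hlow : ∀ n, u ≤ T^[n] b := fun n => by
    refine le_of_tendsto hlim ?_
    filter_upwards [eventually_ge_atTop n] with k hk
    exact hanti (hk.trans ((hφ.id_le k).trans (Nat.le_succ _)))
  have hTlim : Tendsto (fun n => T (T^[φ n + 1] b)) atTop (𝓝 (T u)) := (hT.tendsto u).comp hlim
  refine ⟨u, ge_of_tendsto hlim (Eventually.of_forall fun n => (hstep _).1),
    le_of_tendsto hlim (Eventually.of_forall fun n => (hstep _).2.2), le_antisymm ?_ ?_⟩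
  · refine le_of_tendsto_of_tendsto hTlim hlim (Eventually.of_forall fun n => ?_)
    have := (hstep (φ n + 1)).2.1
    rwa [Function.iterate_succ_apply'] at this
  · refine ge_of_tendsto hTlim (Eventually.of_forall fun n => ?_)
    have := hlow (φ n + 1 + 1)
    rwa [Function.iterate_succ_apply'] at this

theorem norm_le_norm_of_nonneg_of_le {u w : Y} (hu : 0 ≤ u) (h : u ≤ w) : ‖u‖ ≤ ‖w‖ := by
  rw [ContinuousMap.norm_le _ (norm_nonneg _)]
  intro r
  have hur : 0 ≤ u r := hu r
  rw [Real.norm_of_nonneg hur]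
  exact (h r).trans ((le_abs_self _).trans (w.norm_coe_le_norm r))

-- The argument of S_p is bounded when s, λ and w are, so all solutions with such data lie in one
-- compact set.
variable (N hp q) in
theorem exists_isCompact_S_kernelOp_mem (R : ℝ) : ∃ K : Set Y, IsCompact K ∧
    ∀ s lam : ℝ, ∀ w : Y, |s| ≤ R → |lam| ≤ R → ‖w‖ ≤ R → S N hp (lam • kernelOp hp q s w) ∈ K := by
  obtain ⟨C, hC⟩ := ((isCompact_univ (X := unitInterval)).prod
    (isCompact_Icc (a := -(R * R)) (b := R * R))).exists_bound_of_continuousOn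
      q.continuous.continuousOn
  refine ⟨_, isCompact_closure_S_image N hp (R * (C * phi p R)), fun s lam w hs hlam hw => ?_⟩
  have hR : 0 ≤ R := (abs_nonneg s).trans hs
  have hC0 : 0 ≤ C := (norm_nonneg _).trans (hC (0, 0) ⟨mem_univ _, by simp [mul_nonneg hR hR]⟩)
  refine subset_closure ⟨_, ?_, rfl⟩
  rw [mem_closedBall_zero_iff, norm_smul]
  refine mul_le_mul hlam ?_ (norm_nonneg _) hR
  rw [ContinuousMap.norm_le _ (mul_nonneg hC0 (phi_nonneg hR))]
  intro r
  have hwr := (w.norm_coe_le_norm r).trans hw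
  rw [kernelOp_apply, norm_mul]
  refine mul_le_mul (hC _ ⟨mem_univ _, ?_⟩) ?_ (norm_nonneg _) hC0
  · rw [mem_Icc, ← abs_le, abs_mul]
    exact mul_le_mul hs hwr (abs_nonneg _) hR
  · rw [Real.norm_eq_abs, abs_phi]
    exact phi_mono hp hwr

namespace OneSided

variable {f₀ v₀ : Y} {lam₀ : ℝ}

theorem f₀_pos (hq : OneSided p q ρ) (hq0 : ∀ r, q (r, 0) = f₀ r) (r : unitInterval) :
    0 < f₀ r := hq0 r ▸ hq.pos r 0

theorem lam_pos (hq : OneSided p q ρ) (hq0 : ∀ r, q (r, 0) = f₀ r) (hp : 1 < p)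
    (h : IsPrincipal N p f₀ lam₀ v₀) : 0 < lam₀ :=
  pos_of_eigen (hq.f₀_pos hq0) (h.eigen hp) h.nonneg h.ne_zero

/-- Multiples of the principal eigenfunction are strict supersolutions for `λ` near `λ₀`. -/
theorem eventually_supersolution (hq : OneSided p q ρ) (hq0 : ∀ r, q (r, 0) = f₀ r) (hp : 1 < p)
    (h : IsPrincipal N p f₀ lam₀ v₀) {M : ℝ} (hM : 0 < M) (hMρ : ‖M • v₀‖ ≤ ρ) :
    ∀ᶠ lam in 𝓝 lam₀, S N hp (lam • kernelOp hp q 1 (M • v₀)) ≤ M • v₀ := by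
  have hlam₀ := hq.lam_pos hq0 hp h
  set b := M • v₀ with hbdef
  have hb0 : 0 ≤ b := smul_nonneg hM.le h.nonneg
  have hbpos : ∀ r : unitInterval, (r : ℝ) < 1 → 0 < b r := fun r hr => mul_pos hM (h.pos r hr)
  have hbeq : b = S N hp (lam₀ • (f₀ * Phi hp b)) := eigen_smul (h.eigen hp) M
  have hle : kernelOp hp q 1 b ≤ f₀ * Phi hp b := fun r => by
    change q (r, 1 * b r) * phi p (b r) ≤ f₀ r * phi p (b r)
    rw [one_mul, ← hq0]
    exact mul_le_mul_of_nonneg_right (hq.anti r (mem_Ici.mpr le_rfl) (hb0 r) (hb0 r))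
      (phi_nonneg (hb0 r))
  have hne : kernelOp hp q 1 b ≠ f₀ * Phi hp b := fun heq => by
    obtain ⟨r, hr, H⟩ := hq.exists_strict
    have h1 : q (r, 1 * b r) * phi p (b r) = f₀ r * phi p (b r) :=
      congrArg (fun y : Y => y r) heq
    rw [one_mul, ← hq0] at h1
    have h2 : b r ≤ ρ := (le_abs_self _).trans ((b.norm_coe_le_norm r).trans hMρ)
    have h3 := H ⟨le_rfl, hq.rho_pos.le⟩ ⟨hb0 r, h2⟩ (hbpos r hr)
    exact h3.ne (mul_right_cancel₀ (phi_pos (hbpos r hr)).ne' h1)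
  -- The strict gap at λ₀ becomes S_p(λ₀ H(b)) ≤ (1 - d) b, with H the kernel operator; the factor 1
  -- - d then absorbs φ_{p'}(λ/λ₀) for λ near λ₀.
  obtain ⟨c, hc, hcl⟩ := exists_le_S_sub N hp
    (smul_le_smul_of_nonneg_left hle hlam₀.le) (fun heq => hne (smul_right_injective Y hlam₀.ne' heq))
  obtain ⟨d, hd, hdl⟩ := exists_smul_le_of_le N hp hc (lam₀ • (f₀ * Phi hp b))
  rw [← hbeq] at hcl hdl
  have hcont : Continuous fun lam : ℝ => phi (conj p) (lam / lam₀) * (1 - d) :=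
    ((continuous_phi (one_lt_conj hp)).comp (continuous_id.div_const _)).mul continuous_const
  have h1 : phi (conj p) (lam₀ / lam₀) * (1 - d) < 1 := by
    rw [div_self hlam₀.ne', phi_one]
    linarith
  filter_upwards [hcont.continuousAt.eventually_lt_const h1, lt_mem_nhds hlam₀] with lam hlt hlam r
  have h2 : lam • kernelOp hp q 1 b = (lam / lam₀) • (lam₀ • kernelOp hp q 1 b) := by
    rw [smul_smul, div_mul_cancel₀ _ hlam₀.ne']
  rw [h2, S_smul]
  change phi (conj p) (lam / lam₀) * S N hp (lam₀ • kernelOp hp q 1 b) r ≤ b r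
  have h3 : S N hp (lam₀ • kernelOp hp q 1 b) r ≤ (1 - d) * b r := by linarith [hcl r, hdl r]
  calc phi (conj p) (lam / lam₀) * S N hp (lam₀ • kernelOp hp q 1 b) r
      ≤ phi (conj p) (lam / lam₀) * ((1 - d) * b r) :=
        mul_le_mul_of_nonneg_left h3 (phi_nonneg (div_pos hlam hlam₀).le)
    _ = phi (conj p) (lam / lam₀) * (1 - d) * b r := by ring
    _ ≤ 1 * b r := mul_le_mul_of_nonneg_right hlt.le (hb0 r)
    _ = b r := one_mul _

/-- For `λ > λ₀`, small multiples of the principal eigenfunction are subsolutions. -/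
theorem eventually_subsolution (hq : OneSided p q ρ) (hq0 : ∀ r, q (r, 0) = f₀ r) (hp : 1 < p)
    (h : IsPrincipal N p f₀ lam₀ v₀) {lam : ℝ} (hlam : lam₀ < lam) :
    ∀ᶠ η in 𝓝[>] (0 : ℝ), η • v₀ ≤ S N hp (lam • kernelOp hp q 1 (η • v₀)) := by
  have hlam₀ := hq.lam_pos hq0 hp h
  have hlampos := hlam₀.trans hlam
  obtain ⟨r₀, -, hr₀⟩ := isCompact_univ.exists_isMinOn univ_nonempty f₀.continuous.continuousOn
  have hm : 0 < f₀ r₀ := hq.f₀_pos hq0 r₀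
  have hcont : Continuous fun η : ℝ => nemytskii q (η • v₀) :=
    (continuous_nemytskii q).comp (by fun_prop)
  have h0 : nemytskii q ((0 : ℝ) • v₀) = f₀ := by
    ext r
    rw [zero_smul, nemytskii_apply, ContinuousMap.zero_apply, hq0]
  -- With this tolerance λ(f₀ - q) stays below (λ - λ₀) min f₀, hence λ₀ f₀ ≤ λ q(·,ηv₀).
  have h1 : ∀ᶠ η in 𝓝 (0 : ℝ), dist (nemytskii q (η • v₀)) f₀ < (lam - lam₀) / lam * f₀ r₀ := by
    have := hcont.tendsto 0
    rw [h0] at this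
    exact Metric.tendsto_nhds.mp this _ (mul_pos (div_pos (by linarith) hlampos) hm)
  filter_upwards [mem_nhdsWithin_of_mem_nhds h1, self_mem_nhdsWithin] with η hη hηpos
  have hηpos' : 0 < η := hηpos
  have h2 : η • v₀ = S N hp (lam₀ • (f₀ * Phi hp (η • v₀))) := eigen_smul (h.eigen hp) η
  have h3 : lam₀ • (f₀ * Phi hp (η • v₀)) ≤ lam • kernelOp hp q 1 (η • v₀) := fun r => by
    change lam₀ * (f₀ r * phi p (η * v₀ r)) ≤ lam * (q (r, 1 * (η * v₀ r)) * phi p (η * v₀ r))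
    rw [one_mul, ← mul_assoc, ← mul_assoc]
    refine mul_le_mul_of_nonneg_right ?_ (phi_nonneg (mul_nonneg hηpos'.le (h.nonneg r)))
    have h4 := (ContinuousMap.dist_apply_le_dist (f := nemytskii q (η • v₀)) (g := f₀) r).trans_lt hη
    rw [Real.dist_eq] at h4
    have h5 := (abs_lt.mp h4).1
    change _ < q (r, η * v₀ r) - f₀ r at h5
    have h6 : f₀ r₀ ≤ f₀ r := hr₀ (mem_univ r)
    have h7 : lam * ((lam - lam₀) / lam * f₀ r₀) = (lam - lam₀) * f₀ r₀ := by
      field_simp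
    have h8 : (lam - lam₀) * f₀ r₀ ≤ (lam - lam₀) * f₀ r :=
      mul_le_mul_of_nonneg_left h6 (by linarith)
    have h9 := mul_lt_mul_of_pos_left h5 hlampos
    rw [mul_neg, h7] at h9
    linarith
  calc η • v₀ = _ := h2
    _ ≤ _ := S_mono N hp h3

/-- Monotone iteration between ηv₀ and Mv₀ with 0 < η < M. The bound ρ keeps the order interval
where the kernel is increasing, and the lower end excludes the zero solution. -/
theorem eventually_exists_sol (hq : OneSided p q ρ) (hq0 : ∀ r, q (r, 0) = f₀ r) (hp : 1 < p)
    (h : IsPrincipal N p f₀ lam₀ v₀) {M : ℝ} (hM : 0 < M) (hMρ : ‖M • v₀‖ ≤ ρ) :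
    ∀ᶠ lam in 𝓝[>] lam₀, ∃ u, 0 ≤ u ∧ u ≠ 0 ∧ u ≤ M • v₀ ∧ Sol N hp q 1 lam u := by
  have hlam₀ := hq.lam_pos hq0 hp h
  filter_upwards [mem_nhdsWithin_of_mem_nhds (hq.eventually_supersolution hq0 hp h hM hMρ),
    self_mem_nhdsWithin] with lam hsup hlam
  have hlam' : 0 < lam := hlam₀.trans hlam
  obtain ⟨η, ⟨hsub, hηpos⟩, hηM⟩ := (((hq.eventually_subsolution hq0 hp h hlam).and
    self_mem_nhdsWithin).and (mem_nhdsWithin_of_mem_nhds (Iio_mem_nhds hM))).exists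
  have hηpos' : 0 < η := hηpos
  have ha0 : 0 ≤ η • v₀ := smul_nonneg hηpos'.le h.nonneg
  have hnorm : ∀ u, η • v₀ ≤ u → u ≤ M • v₀ → ‖u‖ ≤ ρ := fun u h1 h2 =>
    (norm_le_norm_of_nonneg_of_le (ha0.trans h1) h2).trans hMρ
  obtain ⟨K, hK, hKmem⟩ := exists_isCompact_S_kernelOp_mem N hp q (max (max 1 |lam|) ρ)
  obtain ⟨u, hu1, hu2, hu3⟩ := exists_fixedPoint (T := fun u => S N hp (lam • kernelOp hp q 1 u))
    ((continuous_S N hp).comp ((continuous_smul_kernelOp hp q).comp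
      (by fun_prop : Continuous fun u : Y => ((1 : ℝ), lam, u))))
    (smul_le_smul_of_nonneg_right (le_of_lt hηM) h.nonneg)
    (fun u w h1 h2 h3 => S_mono N hp (smul_le_smul_of_nonneg_left
      (hq.kernelOp_mono (ha0.trans h1) h2 (hnorm w (h1.trans h2) h3)) hlam'.le)) hsub hsup hK
    (fun u h1 h2 => hKmem 1 lam u (by simp) (by simp) ((hnorm u h1 h2).trans (le_max_right _ _)))
  refine ⟨u, ha0.trans hu1, ?_, hu2, hu3.symm⟩
  rintro rfl
  exact smul_ne_zero hηpos'.ne' h.ne_zero (le_antisymm hu1 ha0)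

/-- For all small `s > 0` there is a small positive solution with `σ(u) = s`. -/
theorem eventually_exists_sol_sigma_eq (hq : OneSided p q ρ) (hq0 : ∀ r, q (r, 0) = f₀ r)
    (hp : 1 < p) (h : IsPrincipal N p f₀ lam₀ v₀) {η : ℝ} (hη : 0 < η) :
    ∀ᶠ s in 𝓝[>] (0 : ℝ), ∃ lam u, |lam - lam₀| < η ∧ ‖u‖ < η ∧ Sol N hp q 1 lam u ∧
      sigma N hp f₀ v₀ u = s := by
  have hlam₀ := hq.lam_pos hq0 hp h
  have hf₀ := hq.f₀_pos hq0
  have hsm := sigma_mono N hp (f₀ := f₀) (fun r => (hf₀ r).le) h.nonneg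
  have hcont : Continuous fun M : ℝ => ‖M • v₀‖ := by fun_prop
  have hMev : ∀ᶠ M in 𝓝[>] (0 : ℝ), ‖M • v₀‖ < min ρ η := by
    refine mem_nhdsWithin_of_mem_nhds (hcont.continuousAt.eventually_lt_const ?_)
    simp only [zero_smul, norm_zero]
    exact lt_min hq.rho_pos hη
  obtain ⟨M, hM, hMpos⟩ := (hMev.and self_mem_nhdsWithin).exists
  have hMpos' : 0 < M := hMpos
  have hMρ : ‖M • v₀‖ ≤ ρ := (hM.trans_le (min_le_left _ _)).le
  have hnorm : ∀ {u}, 0 ≤ u → u ≤ M • v₀ → ‖u‖ ≤ ρ := fun h1 h2 =>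
    (norm_le_norm_of_nonneg_of_le h1 h2).trans hMρ
  obtain ⟨L, hL, hLsol⟩ := (mem_nhdsGT_iff_exists_Ioo_subset).mp
    (hq.eventually_exists_sol hq0 hp h hMpos' hMρ)
  have hL' : lam₀ < L := hL
  obtain ⟨b, hb1, hb2⟩ := exists_between (lt_min hL' (by linarith : lam₀ < lam₀ + η))
  have hLsol' : ∀ lam ∈ Ioo lam₀ L, ∃ u, 0 ≤ u ∧ u ≠ 0 ∧ u ≤ M • v₀ ∧ Sol N hp q 1 lam u :=
    fun lam hl => hLsol hl
  choose! u hu0 hune huM husol using hLsol'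
  have hbmem : b ∈ Ioo lam₀ L := ⟨hb1, hb2.trans_le (min_le_left _ _)⟩
  have hσb := sigma_pos N hp hf₀ h.pos (hu0 _ hbmem) (hune _ hbmem) (sol_apply_one N hp (husol _ hbmem))
  filter_upwards [Ioo_mem_nhdsGT hσb] with s hs
  -- As σ(v₀) = 1, a solution below M'v₀ has σ ≤ M' < s; this supplies the lower end for the
  -- intermediate value theorem.
  obtain ⟨M', hM'0, hM's⟩ := exists_between (lt_min hs.1 hMpos')
  have hM'ρ : ‖M' • v₀‖ ≤ ρ := hnorm (smul_nonneg hM'0.le h.nonneg)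
    (smul_le_smul_of_nonneg_right (hM's.le.trans (min_le_right _ _)) h.nonneg)
  obtain ⟨a, ⟨ua, hua0, huane, huaM, huasol⟩, ha⟩ :=
    ((hq.eventually_exists_sol hq0 hp h hM'0 hM'ρ).and (Ioo_mem_nhdsGT hb1)).exists
  have huaρ := (norm_le_norm_of_nonneg_of_le hua0 huaM).trans hM'ρ
  have hσa : sigma N hp f₀ v₀ ua ≤ s := by
    have h1 := hsm huaM
    rw [sigma_smul, h.sigma_self hp, mul_one] at h1
    exact h1.trans (hM's.le.trans (min_le_left _ _))
  have hIcc : ∀ {lam}, lam ∈ Icc a b → lam ∈ Ioo lam₀ L := fun hl =>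
    ⟨ha.1.trans_le hl.1, hl.2.trans_lt hbmem.2⟩
  have hge : ∀ {lam}, lam ∈ Icc a b → ua ≤ u lam := fun {lam} hl =>
    hq.sol_le_sol huasol (husol _ (hIcc hl)) (hlam₀.trans ha.1) hl.1 hua0 (hu0 _ (hIcc hl)) huane
      (hune _ (hIcc hl)) huaρ (hnorm (hu0 _ (hIcc hl)) (huM _ (hIcc hl)))
  obtain ⟨K, hK, hKmem⟩ := exists_isCompact_S_kernelOp_mem N hp q (max (max 1 |L|) ρ)
  -- The lower bound `ua` keeps limits away from 0, so each λ in [a,b] has exactly one solution in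
  -- this compact set.
  have hKI : IsCompact (K ∩ Icc ua (M • v₀)) := hK.inter_right isClosed_Icc
  have hucont : ContinuousOn u (Icc a b) := by
    refine continuousOn_of_unique_zero (P := {x : ℝ × Y | Sol N hp q 1 x.1 x.2})
      ((isClosed_sol N hp q).preimage (by fun_prop : Continuous fun x : ℝ × Y => ((1 : ℝ), x.1, x.2)))
      hKI (fun lam hl => ⟨⟨?_, hge hl, huM _ (hIcc hl)⟩, husol _ (hIcc hl)⟩) fun lam hl w hw hwsol => ?_
    · rw [husol _ (hIcc hl)]
      refine hKmem 1 lam (u lam) (by simp) ?_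
        ((hnorm (hu0 _ (hIcc hl)) (huM _ (hIcc hl))).trans (le_max_right _ _))
      refine le_trans ?_ ((le_max_right 1 |L|).trans (le_max_left _ _))
      have := hlam₀.trans (hIcc hl).1
      rw [abs_of_pos this, abs_of_pos (hlam₀.trans hL')]
      exact (hIcc hl).2.le
    · have hw0 := hua0.trans hw.2.1
      have hwne : w ≠ 0 := fun h0 => huane (le_antisymm (h0 ▸ hw.2.1) hua0)
      have hlpos := hlam₀.trans (hIcc hl).1
      have hρ1 := hnorm hw0 hw.2.2
      have hρ2 := hnorm (hu0 _ (hIcc hl)) (huM _ (hIcc hl))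
      exact le_antisymm
        (hq.sol_le_sol hwsol (husol _ (hIcc hl)) hlpos le_rfl hw0 (hu0 _ (hIcc hl)) hwne
          (hune _ (hIcc hl)) hρ1 hρ2)
        (hq.sol_le_sol (husol _ (hIcc hl)) hwsol hlpos le_rfl (hu0 _ (hIcc hl)) hw0
          (hune _ (hIcc hl)) hwne hρ2 hρ1)
  have hamem : a ∈ Icc a b := ⟨le_rfl, ha.2.le⟩
  -- `u a` was chosen independently of `ua`; comparison at equal λ puts it below `ua`.
  have huale : sigma N hp f₀ v₀ (u a) ≤ s := (hsm (hq.sol_le_sol (husol _ (hIcc hamem)) huasol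
    (hlam₀.trans ha.1) le_rfl (hu0 _ (hIcc hamem)) hua0 (hune _ (hIcc hamem)) huane
    (hnorm (hu0 _ (hIcc hamem)) (huM _ (hIcc hamem))) huaρ)).trans hσa
  obtain ⟨lam, hl, hls⟩ := intermediate_value_Icc ha.2.le
    ((continuous_sigma N hp f₀ v₀).comp_continuousOn hucont) ⟨huale, hs.2.le⟩
  refine ⟨lam, u lam, ?_, ?_, husol _ (hIcc hl), hls⟩
  · rw [abs_of_pos (by linarith [(hIcc hl).1])]
    linarith [hl.2, hb2.trans_le (min_le_right _ _)]
  · exact (norm_le_norm_of_nonneg_of_le (hu0 _ (hIcc hl)) (huM _ (hIcc hl))).trans_lt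
      (hM.trans_le (min_le_right _ _))

end OneSided

end operator

/-! ### Local analysis of the rescaled problem near (0, λ₀, v₀) -/

section operator

variable {N : ℕ} {p : ℝ} {q : C(unitInterval × ℝ, ℝ)} {ρ : ℝ} {f₀ v₀ : Y} {lam₀ : ℝ}

/-- Small non-trivial solutions near `(λ₀,0)` are, after normalization, close to `v₀`. -/
theorem exists_normalized_mem (hp : 1 < p) (hf₀ : ∀ r, 0 < f₀ r) (hq0 : ∀ r, q (r, 0) = f₀ r)
    (h : IsPrincipal N p f₀ lam₀ v₀) {η : ℝ} (hη : 0 < η) :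
    ∃ δ > 0, ∀ lam u, |lam - lam₀| < δ → u ≠ 0 → ‖u‖ < δ → Sol N hp q 1 lam u →
      sigma N hp f₀ v₀ u ≠ 0 ∧ ‖(sigma N hp f₀ v₀ u)⁻¹ • u - v₀‖ < η := by
  have hσc := continuous_sigma N hp f₀ v₀
  set good : Set Y := {w | sigma N hp f₀ v₀ w ≠ 0} ∩
    (fun w => (sigma N hp f₀ v₀ w)⁻¹ • w) ⁻¹' Metric.ball v₀ η
  have hgood : IsOpen good := by
    refine ContinuousOn.isOpen_inter_preimage ?_ (isOpen_ne.preimage hσc) Metric.isOpen_ball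
    exact (hσc.continuousOn.inv₀ fun w hw => hw).smul continuousOn_id
  obtain ⟨K, hK, hKmem⟩ := exists_isCompact_S_kernelOp_mem N hp q (max 1 (|lam₀| + 1))
  -- The unit-norm solutions whose σ-normalization fails to be close to v₀.
  set C : Set ((ℝ × ℝ) × Y) := ((Icc 0 1 ×ˢ Metric.closedBall lam₀ 1) ×ˢ K) ∩
    ({x | Sol N hp q x.1.1 x.1.2 x.2} ∩ {x | ‖x.2‖ = 1} ∩ {x | x.2 ∉ good})
  have hC : IsCompact C := by
    refine ((isCompact_Icc.prod (isCompact_closedBall _ _)).prod hK).inter_right ?_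
    refine (((isClosed_sol N hp q).preimage
      (by fun_prop : Continuous fun x : (ℝ × ℝ) × Y => (x.1.1, x.1.2, x.2))).inter
      (isClosed_eq (by fun_prop) continuous_const)).inter ?_
    exact hgood.isClosed_compl.preimage continuous_snd
  -- Over (0,λ₀) a solution is an eigenfunction, hence cv₀ with c ≠ 0, and its σ-normalization is v₀
  -- whatever the sign of c. The projection of C is compact, so it also misses a neighbourhood.
  have hnot : ((0 : ℝ), lam₀) ∉ Prod.fst '' C := by
    rintro ⟨⟨⟨t, lam⟩, w⟩, ⟨-, ⟨hw1, hw2⟩, hw3⟩, heq⟩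
    obtain ⟨rfl, rfl⟩ := Prod.mk.inj heq
    have hw : w = S N hp (lam • (f₀ * Phi hp w)) := (sol_zero_iff N hp hq0 _ _).mp hw1
    obtain ⟨c, rfl⟩ := eigen_eq_smul hf₀ (h.eigen hp) h.nonneg h.ne_zero hw
    have hc : c ≠ 0 := by
      rintro rfl
      simp at hw2
    refine hw3 ⟨?_, ?_⟩
    · simpa [sigma_smul, h.sigma_self hp] using hc
    · simp only [mem_preimage, sigma_smul, h.sigma_self hp, mul_one, inv_smul_smul₀ hc]
      exact Metric.mem_ball_self hη
  have hev := (hC.image continuous_fst).isClosed.isOpen_compl.mem_nhds hnot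
  obtain ⟨δ, hδ, H⟩ := Metric.mem_nhds_iff.mp hev
  refine ⟨min δ 1, lt_min hδ one_pos, fun lam u hlam hne hu hsol => ?_⟩
  have hn : 0 < ‖u‖ := norm_pos_iff.mpr hne
  set w := ‖u‖⁻¹ • u with hwdef
  have hu' : u = ‖u‖ • w := by rw [hwdef, smul_inv_smul₀ hn.ne']
  have hw1 : ‖w‖ = 1 := by rw [hwdef, norm_smul, norm_inv, norm_norm, inv_mul_cancel₀ hn.ne']
  have hwsol : Sol N hp q ‖u‖ lam w := by
    rw [← one_mul ‖u‖, ← sol_smul_iff N hp q hn.ne', ← hu']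
    exact hsol
  have hball : (‖u‖, lam) ∈ Metric.ball ((0 : ℝ), lam₀) δ := by
    rw [Metric.mem_ball, Prod.dist_eq, max_lt_iff, Real.dist_eq, Real.dist_eq, sub_zero, abs_norm]
    exact ⟨hu.trans_le (min_le_left _ _), hlam.trans_le (min_le_left _ _)⟩
  have hlam1 := hlam.trans_le (min_le_right _ _)
  have hu1 := hu.trans_le (min_le_right _ _)
  have hwgood : w ∈ good := by
    by_contra hcon
    refine H hball ⟨((‖u‖, lam), w), ⟨⟨⟨⟨hn.le, hu1.le⟩, ?_⟩, ?_⟩, ⟨hwsol, hw1⟩, hcon⟩, rfl⟩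
    · exact (Real.dist_eq _ _).trans_le hlam1.le
    · rw [hwsol]
      refine hKmem _ _ _ ?_ ?_ (hw1.trans_le (le_max_left _ _))
      · rw [abs_norm]
        exact hu1.le.trans (le_max_left _ _)
      · refine le_trans ?_ (le_max_right _ _)
        have := abs_sub_abs_le_abs_sub lam lam₀
        linarith
  have hσ : sigma N hp f₀ v₀ u = ‖u‖ * sigma N hp f₀ v₀ w := by
    rw [← sigma_smul, ← hu']
  refine ⟨by rw [hσ]; exact mul_ne_zero hn.ne' hwgood.1, ?_⟩
  have h2 : (sigma N hp f₀ v₀ u)⁻¹ • u = (sigma N hp f₀ v₀ w)⁻¹ • w := by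
    rw [hσ, hwdef, smul_smul, mul_inv_rev]
  rw [h2, ← mem_ball_iff_norm]
  exact hwgood.2

/-- Solutions of the rescaled problem close to `(0,λ₀,v₀)` are non-negative. -/
theorem eventually_sol_nonneg (hp : 1 < p) (hf₀ : ∀ r, 0 < f₀ r) (hq0 : ∀ r, q (r, 0) = f₀ r)
    (h : IsPrincipal N p f₀ lam₀ v₀) :
    ∀ᶠ x : ℝ × ℝ × Y in 𝓝 (0, lam₀, v₀), Sol N hp q x.1 x.2.1 x.2.2 → 0 ≤ x.2.2 := by
  have hlam₀ := pos_of_eigen hf₀ (h.eigen hp) h.nonneg h.ne_zero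
  have h1 := (continuous_smul_kernelOp hp q).tendsto (0, lam₀, v₀)
  simp only [kernelOp_zero_left hp hq0] at h1
  have h2 := h1.eventually (eventually_S_nonneg N hp
    (smul_nonneg hlam₀.le (mul_Phi_nonneg hp hf₀ h.nonneg))
    (smul_ne_zero hlam₀.ne' (mul_Phi_ne_zero hp hf₀ h.ne_zero)))
  filter_upwards [h2] with x hx hsol
  rw [hsol]
  exact hx

/-- Local uniqueness for the rescaled problem. -/
theorem exists_unique_near (hp : 1 < p) (hq : OneSided p q ρ) (hq' : OneSided p (reflect q) ρ)
    (hq0 : ∀ r, q (r, 0) = f₀ r) (h : IsPrincipal N p f₀ lam₀ v₀) :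
    ∃ δ > 0, ∀ s, |s| < δ → ∀ lam₁ lam₂ w₁ w₂, |lam₁ - lam₀| < δ → |lam₂ - lam₀| < δ →
      ‖w₁ - v₀‖ < δ → ‖w₂ - v₀‖ < δ → Sol N hp q s lam₁ w₁ → Sol N hp q s lam₂ w₂ →
      sigma N hp f₀ v₀ w₁ = 1 → sigma N hp f₀ v₀ w₂ = 1 → lam₁ = lam₂ ∧ w₁ = w₂ := by
  have hf₀ := hq.f₀_pos hq0
  have hlam₀ := hq.lam_pos hq0 hp h
  have hsmall : ∀ᶠ x : ℝ × ℝ × Y in 𝓝 (0, lam₀, v₀), 0 < x.2.1 ∧ ‖x.1 • x.2.2‖ < ρ := by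
    have hc₀ : Continuous fun x : ℝ × ℝ × Y => x.2.1 := by fun_prop
    refine ((hc₀.tendsto (0, lam₀, v₀)).eventually_const_lt hlam₀).and ?_
    have hc : Continuous fun x : ℝ × ℝ × Y => ‖x.1 • x.2.2‖ := by fun_prop
    refine hc.continuousAt.eventually_lt_const ?_
    simpa using hq.rho_pos
  obtain ⟨δ, hδ, H⟩ := Metric.eventually_nhds_iff.mp
    ((eventually_sol_nonneg hp hf₀ hq0 h).and hsmall)
  have H' : ∀ {s lam : ℝ} {w : Y}, |s| < δ → |lam - lam₀| < δ → ‖w - v₀‖ < δ → Sol N hp q s lam w →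
      0 ≤ w ∧ 0 < lam ∧ ‖s • w‖ < ρ := fun {s lam w} hs hl hw hsol => by
    have h1 := H (y := (s, lam, w)) (by
      rw [Prod.dist_eq, Prod.dist_eq, max_lt_iff, max_lt_iff, Real.dist_eq, Real.dist_eq,
        dist_eq_norm, sub_zero]
      exact ⟨hs, hl, hw⟩)
    exact ⟨h1.1 hsol, h1.2⟩
  refine ⟨δ, hδ, fun s hs lam₁ lam₂ w₁ w₂ hl₁ hl₂ hw₁ hw₂ hs₁ hs₂ hσ₁ hσ₂ => ?_⟩
  obtain ⟨hw₁0, hl₁0, hρ₁⟩ := H' hs hl₁ hw₁ hs₁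
  obtain ⟨hw₂0, hl₂0, hρ₂⟩ := H' hs hl₂ hw₂ hs₂
  have hne : ∀ {w : Y}, sigma N hp f₀ v₀ w = 1 → w ≠ 0 := by
    rintro _ hσ rfl
    rw [sigma_zero] at hσ
    exact zero_ne_one hσ
  -- Scaling by t = |s| returns to the problem with s = 1; negative s uses the reflected kernel.
  have key : ∀ {q' : C(unitInterval × ℝ, ℝ)} {t : ℝ}, OneSided p q' ρ → 0 < t → |t| = |s| →
      Sol N hp q' t lam₁ w₁ → Sol N hp q' t lam₂ w₂ → lam₁ = lam₂ ∧ w₁ = w₂ :=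
    fun {q' t} hq' ht hts h₁ h₂ => by
      have hn : ∀ w : Y, ‖t • w‖ = ‖s • w‖ := fun w => by
        rw [norm_smul, norm_smul, Real.norm_eq_abs, Real.norm_eq_abs, hts]
      rw [← one_mul t, ← sol_smul_iff N hp q' ht.ne'] at h₁ h₂
      obtain ⟨h3, h4⟩ := hq'.sol_unique hf₀ h.pos h₁ h₂ hl₁0 hl₂0 (smul_nonneg ht.le hw₁0)
        (smul_nonneg ht.le hw₂0) (smul_ne_zero ht.ne' (hne hσ₁)) (smul_ne_zero ht.ne' (hne hσ₂))
        ((hn _).trans_le hρ₁.le) ((hn _).trans_le hρ₂.le)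
        (by rw [sigma_smul, sigma_smul, hσ₁, hσ₂])
      exact ⟨h3, smul_right_injective Y ht.ne' h4⟩
  rcases lt_trichotomy s 0 with hs0 | rfl | hs0
  · refine key hq' (neg_pos.mpr hs0) (abs_neg s) ?_ ?_
    · rwa [sol_reflect_iff, neg_neg]
    · rwa [sol_reflect_iff, neg_neg]
  · rw [sol_zero_iff N hp hq0] at hs₁ hs₂
    obtain ⟨h1, c, -, h2⟩ := eigen_unique hf₀ hs₂ hw₂0 (hne hσ₂) hs₁ hw₁0 (hne hσ₁)
    refine ⟨h1, ?_⟩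
    rw [h2, sigma_smul, hσ₂, mul_one] at hσ₁
    rw [h2, hσ₁, one_smul]
  · exact key hq hs0 rfl hs₁ hs₂

/-- Local existence for the rescaled problem, for `s > 0`. -/
theorem OneSided.eventually_exists_near (hp : 1 < p) (hq : OneSided p q ρ)
    (hq0 : ∀ r, q (r, 0) = f₀ r) (h : IsPrincipal N p f₀ lam₀ v₀) {η : ℝ} (hη : 0 < η) :
    ∀ᶠ s in 𝓝[>] (0 : ℝ), ∃ lam w, |lam - lam₀| < η ∧ ‖w - v₀‖ < η ∧ Sol N hp q s lam w ∧
      sigma N hp f₀ v₀ w = 1 := by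
  -- For a solution u with σ(u) = s, the σ-normalization is s⁻¹u, the required w.
  obtain ⟨δ, hδ, H⟩ := exists_normalized_mem hp (hq.f₀_pos hq0) hq0 h hη
  filter_upwards [hq.eventually_exists_sol_sigma_eq hq0 hp h (lt_min hδ hη), self_mem_nhdsWithin]
    with s hs hs0
  have hs0' : 0 < s := hs0
  obtain ⟨lam, u, hl, hu, hsol, hσ⟩ := hs
  have hne : u ≠ 0 := by
    rintro rfl
    rw [sigma_zero] at hσ
    exact hs0'.ne hσ
  obtain ⟨-, h2⟩ := H lam u (hl.trans_le (min_le_left _ _)) hne (hu.trans_le (min_le_left _ _)) hsol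
  rw [hσ] at h2
  refine ⟨lam, s⁻¹ • u, hl.trans_le (min_le_right _ _), h2, ?_, ?_⟩
  · rw [← one_mul s, ← sol_smul_iff N hp q hs0'.ne', one_mul, smul_inv_smul₀ hs0'.ne']
    exact hsol
  · rw [sigma_smul, hσ, inv_mul_cancel₀ hs0'.ne']

theorem eventually_exists_near (hp : 1 < p) (hq : OneSided p q ρ) (hq' : OneSided p (reflect q) ρ)
    (hq0 : ∀ r, q (r, 0) = f₀ r) (h : IsPrincipal N p f₀ lam₀ v₀) {η : ℝ} (hη : 0 < η) :
    ∀ᶠ s in 𝓝 (0 : ℝ), ∃ lam w, |lam - lam₀| < η ∧ ‖w - v₀‖ < η ∧ Sol N hp q s lam w ∧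
      sigma N hp f₀ v₀ w = 1 := by
  have h1 := hq.eventually_exists_near hp hq0 h hη
  have h2 := hq'.eventually_exists_near hp (fun r => by rw [reflect_apply, neg_zero, hq0]) h hη
  rw [eventually_nhdsWithin_iff] at h1 h2
  have h3 := (continuous_neg (G := ℝ)).tendsto 0
  rw [neg_zero] at h3
  filter_upwards [h1, h3.eventually h2] with s hs1 hs2
  rcases lt_trichotomy s 0 with hs0 | rfl | hs0
  · obtain ⟨lam, w, e1, e2, e3, e4⟩ := hs2 (neg_pos.mpr hs0)
    rw [sol_reflect_iff, neg_neg] at e3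
    exact ⟨lam, w, e1, e2, e3, e4⟩
  · exact ⟨lam₀, v₀, by simpa, by simpa, (sol_zero_iff N hp hq0 _ _).mpr (h.eigen hp),
      h.sigma_self hp⟩
  · exact hs1 hs0

theorem sigma_add_coe (hp : 1 < p) (h : IsPrincipal N p f₀ lam₀ v₀) (z : Z N hp f₀ v₀) :
    sigma N hp f₀ v₀ (v₀ + z) = 1 := by
  have h1 := sigma_sub N hp f₀ v₀ (v₀ + z) z
  rw [add_sub_cancel_right, h.sigma_self hp, (mem_Z_iff N hp f₀ v₀ z).mp z.2, sub_zero] at h1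
  exact h1.symm

theorem sub_mem_Z (hp : 1 < p) (h : IsPrincipal N p f₀ lam₀ v₀) {w : Y}
    (hw : sigma N hp f₀ v₀ w = 1) : w - v₀ ∈ Z N hp f₀ v₀ := by
  rw [mem_Z_iff, sigma_sub, hw, h.sigma_self hp, sub_self]

end operator

/-! ### The branch -/

section branch

variable {N : ℕ} {p : ℝ} {f : C(unitInterval × ℝ, ℝ)} {f₀ finf v₀ : Y} {lam₀ : ℝ}

/-- Existence and uniqueness at each fixed s define the map; continuity follows from compactness of
S_p and closedness of the solution set. -/
theorem exists_isLocalBranch (hp : 1 < p) (hf : Hyp N p f f₀ finf)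
    (h : IsPrincipal N p f₀ lam₀ v₀) :
    ∃ (ε : ℝ) (U : Set (ℝ × Z N hp f₀ v₀)) (lam : ℝ → ℝ) (z : ℝ → Z N hp f₀ v₀),
      IsLocalBranch N hp f f₀ lam₀ v₀ ε U lam z := by
  obtain ⟨ρ, hq, hq'⟩ := hf.exists_oneSided hp
  have hq0 := hf.quot_zero hp
  set q := hf.quot hp
  obtain ⟨δ, hδ, huniq⟩ := exists_unique_near hp hq hq' hq0 h
  -- Existence within δ/2 puts the branch in closed balls that still lie inside the open δ-balls of
  -- uniqueness.
  obtain ⟨ε', hε', hex⟩ := Metric.eventually_nhds_iff.mp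
    (eventually_exists_near hp hq hq' hq0 h (half_pos hδ))
  set ε := min ε' δ
  have hε : 0 < ε := lt_min hε' hδ
  have habs : ∀ {s}, s ∈ Ioo (-ε) ε → |s| < ε := fun hs => abs_lt.mpr hs
  have hex' : ∀ s ∈ Ioo (-ε) ε, ∃ (lam : ℝ) (z : Z N hp f₀ v₀), |lam - lam₀| < δ / 2 ∧
      ‖z‖ < δ / 2 ∧ Sol N hp q s lam (v₀ + z) := fun s hs => by
    obtain ⟨lam, w, h1, h2, h3, h4⟩ := hex (y := s)
      (by rw [Real.dist_eq, sub_zero]; exact (habs hs).trans_le (min_le_left _ _))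
    exact ⟨lam, ⟨w - v₀, sub_mem_Z hp h h4⟩, h1, h2, by rwa [add_sub_cancel]⟩
  choose! lam z hlam hz hsol using hex'
  have hnorm : ∀ z : Z N hp f₀ v₀, ‖(v₀ + z : Y) - v₀‖ = ‖z‖ := fun z => by
    rw [add_sub_cancel_left]
    rfl
  have hu : ∀ s ∈ Ioo (-ε) ε, ∀ (lam' : ℝ) (w : Y), |lam' - lam₀| < δ → ‖w - v₀‖ < δ →
      Sol N hp q s lam' w → sigma N hp f₀ v₀ w = 1 → lam' = lam s ∧ w = v₀ + z s :=
    fun s hs lam' w h1 h2 h3 h4 =>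
      huniq s ((habs hs).trans_le (min_le_right _ _)) lam' (lam s) w (v₀ + z s) h1
        ((hlam s hs).trans (half_lt_self hδ)) h2
        ((hnorm _).trans_lt ((hz s hs).trans (half_lt_self hδ))) h3 (hsol s hs) h4
        (sigma_add_coe hp h _)
  have h0mem : (0 : ℝ) ∈ Ioo (-ε) ε := ⟨neg_lt_zero.mpr hε, hε⟩
  obtain ⟨hl0, hz0⟩ := hu 0 h0mem lam₀ v₀ (by simpa) (by simpa)
    ((sol_zero_iff N hp hq0 _ _).mpr (h.eigen hp)) (h.sigma_self hp)
  refine ⟨ε, Metric.ball (lam₀, 0) δ, lam, z, hε, Metric.ball_mem_nhds _ hδ, ?_, hl0.symm, ?_, ?_⟩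
  · obtain ⟨K, hK, hKmem⟩ := exists_isCompact_S_kernelOp_mem N hp q
      (max ε (max (|lam₀| + δ) (‖v₀‖ + δ)))
    have hcont : ContinuousOn (fun s => (lam s, (v₀ + z s : Y))) (Ioo (-ε) ε) := by
      refine continuousOn_of_unique_zero
        (P := {x : ℝ × ℝ × Y | Sol N hp q x.1 x.2.1 x.2.2} ∩ {x | sigma N hp f₀ v₀ x.2.2 = 1})
        (K := Metric.closedBall lam₀ (δ / 2) ×ˢ (K ∩ Metric.closedBall v₀ (δ / 2))) ?_ ?_ ?_ ?_
      · exact (isClosed_sol N hp q).inter (isClosed_eq ((continuous_sigma N hp f₀ v₀).comp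
          (continuous_snd.comp continuous_snd)) continuous_const)
      · exact (isCompact_closedBall _ _).prod (hK.inter_right Metric.isClosed_closedBall)
      · refine fun s hs => ⟨⟨?_, ?_, ?_⟩, hsol s hs, sigma_add_coe hp h _⟩
        · exact (Real.dist_eq _ _).trans_le (hlam s hs).le
        · change (v₀ + z s : Y) ∈ K
          rw [hsol s hs]
          refine hKmem _ _ _ ((habs hs).le.trans (le_max_left _ _)) ?_ ?_
          · refine le_trans ?_ ((le_max_left _ _).trans (le_max_right _ _))
            have := abs_sub_abs_le_abs_sub (lam s) lam₀
            linarith [hlam s hs]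
          · refine le_trans (norm_add_le _ _) (le_trans ?_ ((le_max_right _ _).trans (le_max_right _ _)))
            have h1 : ‖(z s : Y)‖ < δ / 2 := hz s hs
            linarith
        · rw [mem_closedBall_iff_norm, hnorm]
          exact (hz s hs).le
      · rintro s hs ⟨l, w⟩ ⟨h1, -, h2⟩ ⟨h3, h4⟩
        rw [Metric.mem_closedBall, Real.dist_eq] at h1
        rw [mem_closedBall_iff_norm] at h2
        obtain ⟨h5, h6⟩ := hu s hs l w (h1.trans_lt (half_lt_self hδ))
          (h2.trans_lt (half_lt_self hδ)) h3 h4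
        rw [h5, h6]
    refine (continuousOn_fst.comp hcont (mapsTo_univ _ _)).prodMk ?_
    rw [Topology.IsInducing.subtypeVal.continuousOn_iff]
    have hsub : ContinuousOn (fun s => (v₀ + z s : Y) - v₀) (Ioo (-ε) ε) :=
      (continuousOn_snd.comp hcont (mapsTo_univ _ _)).sub continuousOn_const
    exact hsub.congr fun s _ => by simp
  · exact Subtype.ext (left_eq_add.mp hz0)
  · ext ⟨s, l, y⟩
    simp only [mem_ofPred_eq, mem_image, Prod.mk.injEq, hf.G_eq_zero_iff]
    constructor
    · rintro ⟨hs, hU, hG⟩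
      rw [Metric.mem_ball, Prod.dist_eq, max_lt_iff, Real.dist_eq, dist_zero_right] at hU
      obtain ⟨h1, h2⟩ := hu s hs l _ hU.1 ((hnorm _).trans_lt hU.2) hG (sigma_add_coe hp h _)
      exact ⟨s, hs, rfl, h1.symm, Subtype.ext (add_left_cancel h2).symm⟩
    · rintro ⟨s, hs, rfl, rfl, rfl⟩
      refine ⟨hs, ?_, hsol s hs⟩
      rw [Metric.mem_ball, Prod.dist_eq, max_lt_iff, Real.dist_eq, dist_zero_right]
      exact ⟨(hlam s hs).trans (half_lt_self hδ), (hz s hs).trans (half_lt_self hδ)⟩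

/-- A non-trivial solution near (λ₀,0) has u = s(v₀ + z) with s = σ(u) and z ∈ Z small, so (s,λ,z)
lies where the given branch exhausts the zeros of G. Since v₀ + z(s) ≥ 0 for small s, the sign of u
is that of s. -/
theorem IsLocalBranch.exists_neighbourhood (hp : 1 < p) (hf : Hyp N p f f₀ finf)
    (h : IsPrincipal N p f₀ lam₀ v₀) {ε : ℝ} {U : Set (ℝ × Z N hp f₀ v₀)} {lam : ℝ → ℝ}
    {z : ℝ → Z N hp f₀ v₀} (hb : IsLocalBranch N hp f f₀ lam₀ v₀ ε U lam z) :
    ∃ ε₁ ∈ Ioo 0 ε, ∃ U₁ ∈ 𝓝 ((lam₀, 0) : ℝ × Y),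
      {x ∈ U₁ | F N hp f x.1 x.2 = 0} =
        {x ∈ U₁ | x.2 = 0} ∪ branchPoint v₀ lam z '' Ioo (-ε₁) ε₁ ∧
      branchPoint v₀ lam z '' Ioo (-ε₁) 0 ⊆ solNeg N hp f ∧
      branchPoint v₀ lam z '' Ioo 0 ε₁ ⊆ solPos N hp f := by
  have hf₀ := hf.f₀_pos hp
  have hq0 := hf.quot_zero hp
  have hlam₀ := pos_of_eigen hf₀ (h.eigen hp) h.nonneg h.ne_zero
  set q := hf.quot hp
  have hsol : ∀ s ∈ Ioo (-ε) ε, Sol N hp q s (lam s) (v₀ + z s) := fun s hs => by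
    have h1 : (s, lam s, z s) ∈ (fun s => (s, lam s, z s)) '' Ioo (-ε) ε := ⟨s, hs, rfl⟩
    rw [← hb.zeros] at h1
    exact (hf.G_eq_zero_iff v₀ s (lam s) (z s)).mp h1.2.2
  have hcont : ContinuousAt (fun s => (lam s, z s)) 0 :=
    hb.continuousOn.continuousAt (Ioo_mem_nhds (neg_lt_zero.mpr hb.pos) hb.pos)
  have hcl : ContinuousAt lam 0 := continuous_fst.continuousAt.comp hcont
  have hcw : ContinuousAt (fun s => (v₀ + z s : Y)) 0 :=
    continuousAt_const.add ((continuous_subtype_val.comp continuous_snd).continuousAt.comp hcont)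
  have hw0 : (v₀ + z 0 : Y) = v₀ := by rw [hb.z_zero, Submodule.coe_zero, add_zero]
  obtain ⟨η, hη, hηU⟩ := Metric.mem_nhds_iff.mp hb.nhds
  obtain ⟨δ', hδ', hnormal⟩ := exists_normalized_mem hp hf₀ hq0 h hη
  set δ := min δ' η
  have hδ : 0 < δ := lt_min hδ' hη
  have hev1 : ∀ᶠ s in 𝓝 (0 : ℝ), Sol N hp q s (lam s) (v₀ + z s) → 0 ≤ (v₀ + z s : Y) := by
    have h1 : Tendsto (fun s => (s, lam s, (v₀ + z s : Y))) (𝓝 0) (𝓝 (0, lam₀, v₀)) := by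
      have h2 := continuousAt_id.prodMk (hcl.prodMk hcw)
      rw [ContinuousAt, hw0, hb.lam_zero] at h2
      exact h2
    exact h1.eventually (eventually_sol_nonneg hp hf₀ hq0 h)
  have hev2 : ∀ᶠ s in 𝓝 (0 : ℝ), 0 < lam s :=
    hcl.eventually_const_lt (by rwa [hb.lam_zero])
  have hev3 : ∀ᶠ s in 𝓝 (0 : ℝ), |lam s - lam₀| < δ :=
    (hcl.sub continuousAt_const).abs.eventually_lt_const (by simpa [hb.lam_zero])
  have hev4 : ∀ᶠ s in 𝓝 (0 : ℝ), ‖s • (v₀ + z s : Y)‖ < δ :=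
    (continuousAt_id.smul hcw).norm.eventually_lt_const (by simpa)
  obtain ⟨ε', hε', H⟩ := Metric.eventually_nhds_iff.mp (hev1.and (hev2.and (hev3.and hev4)))
  obtain ⟨ε₁, hε₁0, hε₁⟩ := exists_between (lt_min hε' hb.pos)
  have hε₁ε : ε₁ < ε := hε₁.trans_le (min_le_right _ _)
  have hsub : ∀ {s}, |s| < ε₁ → s ∈ Ioo (-ε) ε := fun hs => abs_lt.mp (hs.trans hε₁ε)
  have H' : ∀ {s}, |s| < ε₁ → 0 ≤ (v₀ + z s : Y) ∧ 0 < lam s ∧ |lam s - lam₀| < δ ∧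
      ‖s • (v₀ + z s : Y)‖ < δ := fun {s} hs => by
    obtain ⟨h1, h2⟩ := H (y := s) (by
      rw [Real.dist_eq, sub_zero]
      exact hs.trans (hε₁.trans_le (min_le_left _ _)))
    exact ⟨h1 (hsol s (hsub hs)), h2⟩
  have hne : ∀ s, (v₀ + z s : Y) ≠ 0 := fun s h0 => by
    have h1 := sigma_add_coe hp h (z s)
    rw [h0, sigma_zero] at h1
    exact zero_ne_one h1
  have hF0 : ∀ l, F N hp f l 0 = 0 := fun l => by
    have h1 : kernelOp hp q 1 0 = 0 := by
      ext r
      simp [kernelOp_apply, phi_zero]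
    rw [hf.F_eq_zero_iff, Sol, h1, smul_zero, S_zero]
  have hF : ∀ {s}, |s| < ε₁ → F N hp f (lam s) (s • (v₀ + z s : Y)) = 0 := fun {s} hs => by
    rcases eq_or_ne s 0 with rfl | hs0
    · rw [zero_smul, hF0]
    · rw [hf.F_eq_zero_iff, sol_smul_iff N hp _ hs0, one_mul]
      exact hsol s (hsub hs)
  have hσ : ∀ s, sigma N hp f₀ v₀ (s • (v₀ + z s : Y)) = s := fun s => by
    rw [sigma_smul, sigma_add_coe hp h, mul_one]
  -- Since σ recovers s from s(v₀ + z(s)), the bound on σ makes the parameter interval exactly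
  -- (-ε₁,ε₁).
  set U₁ : Set (ℝ × Y) := {x | |x.1 - lam₀| < δ ∧ ‖x.2‖ < δ ∧ |sigma N hp f₀ v₀ x.2| < ε₁}
  have hU₁ : IsOpen U₁ := by
    have hc := (continuous_sigma N hp f₀ v₀).comp (continuous_snd (X := ℝ) (Y := Y))
    exact (isOpen_lt (f := fun x : ℝ × Y => |x.1 - lam₀|) (by fun_prop) continuous_const).inter
      ((isOpen_lt (f := fun x : ℝ × Y => ‖x.2‖) (by fun_prop) continuous_const).inter
        (isOpen_lt hc.abs continuous_const))
  refine ⟨ε₁, ⟨hε₁0, hε₁ε⟩, U₁, hU₁.mem_nhds ⟨by simpa, by simpa, by simpa [sigma_zero]⟩,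
    ?_, ?_, ?_⟩
  · ext ⟨l, u⟩
    constructor
    · rintro ⟨hU, hFu⟩
      rcases eq_or_ne u 0 with rfl | hu0
      · exact Or.inl ⟨hU, rfl⟩
      right
      obtain ⟨hl, hu, hs⟩ := hU
      simp only at hl hu hs hFu
      rw [hf.F_eq_zero_iff] at hFu
      obtain ⟨h1, h2⟩ := hnormal l u (hl.trans_le (min_le_left _ _)) hu0
        (hu.trans_le (min_le_left _ _)) hFu
      set s := sigma N hp f₀ v₀ u with hsdef
      have h3 : sigma N hp f₀ v₀ (s⁻¹ • u) = 1 := by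
        rw [sigma_smul, ← hsdef, inv_mul_cancel₀ h1]
      set y : Z N hp f₀ v₀ := ⟨s⁻¹ • u - v₀, sub_mem_Z hp h h3⟩ with hydef
      have hy : s • (v₀ + y : Y) = u := by rw [hydef, add_sub_cancel, smul_inv_smul₀ h1]
      have h4 : (s, l, y) ∈ {x : ℝ × ℝ × Z N hp f₀ v₀ |
          x.1 ∈ Ioo (-ε) ε ∧ x.2 ∈ U ∧ G N hp f f₀ v₀ x.1 x.2.1 x.2.2 = 0} := by
        refine ⟨hsub hs, hηU ?_, ?_⟩
        · rw [Metric.mem_ball, Prod.dist_eq, max_lt_iff, Real.dist_eq, dist_zero_right]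
          exact ⟨hl.trans_le (min_le_right _ _), h2⟩
        · rw [hf.G_eq_zero_iff]
          rw [← hy, sol_smul_iff N hp _ h1, one_mul] at hFu
          exact hFu
      rw [hb.zeros] at h4
      obtain ⟨s', -, heq⟩ := h4
      simp only [Prod.mk.injEq] at heq
      obtain ⟨rfl, h5, h6⟩ := heq
      refine ⟨_, abs_lt.mp hs, ?_⟩
      rw [branchPoint, h5, h6, hy]
    · rintro (⟨hU, hu⟩ | ⟨s, hs, heq⟩)
      · simp only at hu
        subst hu
        exact ⟨hU, hF0 l⟩
      · rw [← heq]
        have hs' := abs_lt.mpr hs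
        obtain ⟨-, -, h1, h2⟩ := H' hs'
        exact ⟨⟨h1, h2, by rw [branchPoint, hσ]; exact hs'⟩, hF hs'⟩
  · rintro _ ⟨s, hs, rfl⟩
    have hs' : |s| < ε₁ := abs_lt.mpr ⟨hs.1, hs.2.trans hε₁0⟩
    obtain ⟨h1, h2, -⟩ := H' hs'
    exact ⟨h2, hF hs', smul_ne_zero hs.2.ne (hne s), fun r =>
      mul_nonpos_of_nonpos_of_nonneg hs.2.le (h1 r)⟩
  · rintro _ ⟨s, hs, rfl⟩
    have hs' : |s| < ε₁ := abs_lt.mpr ⟨by linarith [hs.1], hs.2⟩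
    obtain ⟨h1, h2, -⟩ := H' hs'
    exact ⟨h2, hF hs', smul_ne_zero hs.1.ne' (hne s), fun r => mul_nonneg hs.1.le (h1 r)⟩

end branch

end

end RadialPLaplacian

open RadialPLaplacian in
theorem mainTheorem6 (N : ℕ) (hN : 1 ≤ N) (p : ℝ) (hp : 2 < p)
    (f : C(unitInterval × ℝ, ℝ)) (f₀ finf : Y) (hf : Hyp N p f f₀ finf) :
    (∃! x : ℝ × Y, IsPrincipal N p f₀ x.1 x.2) ∧
    ∀ (lam₀ : ℝ) (v₀ : Y), IsPrincipal N p f₀ lam₀ v₀ →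
      (∃ (ε : ℝ) (U : Set (ℝ × Z N (one_lt_two.trans hp) f₀ v₀)) (lam : ℝ → ℝ)
        (z : ℝ → Z N (one_lt_two.trans hp) f₀ v₀),
        IsLocalBranch N (one_lt_two.trans hp) f f₀ lam₀ v₀ ε U lam z) ∧
      ∀ (ε : ℝ) (U : Set (ℝ × Z N (one_lt_two.trans hp) f₀ v₀)) (lam : ℝ → ℝ)
        (z : ℝ → Z N (one_lt_two.trans hp) f₀ v₀),
        IsLocalBranch N (one_lt_two.trans hp) f f₀ lam₀ v₀ ε U lam z →
        ∃ ε₁ ∈ Ioo 0 ε, ∃ U₁ ∈ 𝓝 ((lam₀, 0) : ℝ × Y),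
          {x ∈ U₁ | F N (one_lt_two.trans hp) f x.1 x.2 = 0} =
            {x ∈ U₁ | x.2 = 0} ∪ branchPoint v₀ lam z '' Ioo (-ε₁) ε₁ ∧
          branchPoint v₀ lam z '' Ioo (-ε₁) 0 ⊆ solNeg N (one_lt_two.trans hp) f ∧
          branchPoint v₀ lam z '' Ioo 0 ε₁ ⊆ solPos N (one_lt_two.trans hp) f := by
  have hp' : 1 < p := one_lt_two.trans hp
  exact ⟨existsUnique_isPrincipal hp' (hf.f₀_pos hp'), fun lam₀ v₀ h =>
    ⟨exists_isLocalBranch hp' hf h, fun ε U lam z hb => hb.exists_neighbourhood hp' hf h⟩⟩
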